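/- \textbf{Setting.} Fix a vocabulary with countably infinitely many constants and, for every arity, countably infinitely many predicates. An atom is $p(t_1,\dots,t_k)$ with each $t_i$ a variable or a constant. A fact is an atom without variables; a fact base is a finite set of facts. A Boolean conjunctive query (CQ) is an existentially closed finite conjunction of atoms, identified with its set of atoms; it is atomic if it is a single atom. An (existential) rule is a sentence $\forall \vec x\,\forall\vec y\,(B[\vec x,\vec y]\to\exists\vec z\,H[\vec x,\vec z])$ with $B$ (body) and $H$ (head) finite conjunctions of atoms; the variables $\vec z$, which occur only in $H$, are its existential variables. A knowledge base (KB) $(\mathcal F,\mathcal R)$ consists of a fact base and a finite set of rules, and $\models$ is first-order entailment. \textbf{fes.} A model $M$ of $(\mathcal F,\mathcal R)$ is universal if for every CQ $Q$: $M\models Q$ iff $\mathcal F,\mathcal R\models Q$. A finite rule set $\mathcal R$ is a finite expansion set (fes) if for every fact base $\mathcal F$ the KB $(\mathcal F,\mathcal R)$ has a finite universal model. \textbf{fus.} Let $Q$ be a CQ and $R=B\to H$ a rule with variables renamed so that they do not occur in $Q$. A piece-unifier of $Q$ with $R$ is a triple $(Q',H',P)$ with $\emptyset\ne Q'\subseteq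 Q$, $H'\subseteq H$ and $P$ a partition of the terms of $Q'\cup H'$ in which no class contains two constants, such that (1) $\sigma(H')=\sigma(Q')$, where $\sigma$ is any substitution that maps all terms of each class to one selected element of the class, a constant if the class contains one; (2) if a class contains an existential variable of $R$, its other terms are variables of $Q'$ that do not occur in $Q\setminus Q'$. It is single-piece if there is no nonempty proper subset $Q''$ of $Q'$ such that no term of $Q''$ lying in the class of an existential variable occurs in $Q\setminus Q''$. A direct rewriting of $Q$ with $R$ is a CQ $\sigma(Q\setminus Q')\cup\sigma(B)$ obtained from a single-piece unifier and a substitution $\sigma$ as above. A rewriting of $Q$ w.r.t. $\mathcal R$ is a CQ obtained from $Q$ by a finite, possibly empty, sequence of direct rewritings with rules of $\mathcal R$. A finite rule set $\mathcal R$ is a finite unification set (fus) if for every CQ $Q$ there is a finite set $S$ of rewritings of $Q$ w.r.t. $\mathcal R$ such that for every fact base $\mathcal F$: $\mathcal F,\mathcal R\models Q$ iff $\mathcal F\models Q'$ for some $Q'\in S$. \textbf{Adding transitivity.} A transitivity rule is a rule $p(x,y)\wedge p(y,z)\to p(x,z)$ with $p$ a binary predicate and $x,y,z$ distinct variables. For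 a class $\mathcal C$ of finite rule sets, $\mathcal C$+trans is the class of the rule sets $\mathcal R\cup\mathcal T$ with $\mathcal R\in\mathcal C$ and $\mathcal T$ a finite set of transitivity rules. \textbf{Statement.} Atomic CQ entailment over fus+trans KBs is undecidable, and atomic CQ entailment over fes+trans KBs is undecidable. That is, for $\mathcal C=$ fus and for $\mathcal C=$ fes, there is no algorithm that, for every KB $(\mathcal F,\mathcal R)$ with $\mathcal R\in\mathcal C$+trans and every atomic CQ $Q$ given as input, halts and correctly answers whether $\mathcal F,\mathcal R\models Q$ (its behaviour on other inputs being arbitrary). -/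

import Mathlib

namespace ExRule

/-! ### Syntax

The vocabulary has countably many constants and, for every arity, countably many predicates. -/

/-- A term: `Sum.inl x` is the variable `x`, `Sum.inr c` is the constant `c`. -/
abbrev Term := ℕ ⊕ ℕ

/-- The variable `x` as a term. -/
abbrev var (x : ℕ) : Term := Sum.inl x

/-- The constant `c` as a term. -/
abbrev cst (c : ℕ) : Term := Sum.inr c

/-- An atom `p(t₁, …, tₖ)` is a predicate name together with its list of arguments. The predicate is
determined by its name and its arity `k`: one name used with two arities gives two predicates. -/
abbrev Atom := ℕ × List Term

/-- A fact, i.e. an atom without variables; the arguments are constants. -/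
abbrev Fact := ℕ × List ℕ

/-- A Boolean conjunctive query: the set of atoms of an existentially closed conjunction. -/
abbrev CQ := Finset Atom

/-- An existential rule `B → H`, given by the list of atoms of its body and that of its head. -/
abbrev Rule := List Atom × List Atom

/-- A knowledge base: a finite list of facts and a finite list of rules. -/
abbrev KB := List Fact × List Rule

/-- The fact base of a knowledge base. -/
def KB.factBase (K : KB) : Finset Fact := K.1.toFinset

/-- The rule set of a knowledge base. -/
def KB.ruleSet (K : KB) : Finset Rule := K.2.toFinset

/-- The body of a rule, as a set of atoms. -/
def Rule.body (R : Rule) : Finset Atom := R.1.toFinset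

/-- The head of a rule, as a set of atoms. -/
def Rule.head (R : Rule) : Finset Atom := R.2.toFinset

/-- The terms that occur in a set of atoms. -/
def terms (A : Finset Atom) : Set Term := {t | ∃ a ∈ A, t ∈ a.2}

/-- The variables that occur in a set of atoms. -/
def vars (A : Finset Atom) : Set ℕ := {x | var x ∈ terms A}

/-- The variables of a rule. -/
def Rule.vars (R : Rule) : Set ℕ := ExRule.vars R.body ∪ ExRule.vars R.head

/-- The existential variables of a rule: those that occur only in its head. -/
def Rule.existVars (R : Rule) : Set ℕ := ExRule.vars R.head \ ExRule.vars R.body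

/-! ### First-order semantics -/

/-- A first-order interpretation with domain `D`. The relation that interprets the `k`-ary predicate
with name `p` is the restriction of `rel p` to lists of length `k`. -/
structure Interp (D : Type) where
  /-- The interpretation of the constants. -/
  const : ℕ → D
  /-- The interpretation of the predicates. -/
  rel : ℕ → List D → Prop

namespace Interp

variable {D : Type}

/-- The value of a term under the variable assignment `v`. -/
def val (M : Interp D) (v : ℕ → D) : Term → D := Sum.elim v M.const

/-- An atom holds under the variable assignment `v`. -/
def Holds (M : Interp D) (v : ℕ → D) (a : Atom) : Prop := M.rel a.1 (a.2.map (M.val v))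

/-- `M` satisfies a fact. -/
def SatFact (M : Interp D) (f : Fact) : Prop := M.rel f.1 (f.2.map M.const)

/-- `M` satisfies the existential closure of the conjunction of the atoms of `Q`. -/
def SatCQ (M : Interp D) (Q : CQ) : Prop := ∃ v : ℕ → D, ∀ a ∈ Q, M.Holds v a

/-- `M` satisfies the sentence `∀ x y, (B[x, y] → ∃ z, H[x, z])`: every assignment that makes the
body true can be changed outside the variables of the body so that the head becomes true. -/
def SatRule (M : Interp D) (R : Rule) : Prop :=
  ∀ v : ℕ → D, (∀ a ∈ R.body, M.Holds v a) →
    ∃ w : ℕ → D, (∀ x ∈ vars R.body, w x = v x) ∧ ∀ a ∈ R.head, M.Holds w a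

/-- `M` is a model of the knowledge base `(F, 𝓡)`. -/
def IsModel (M : Interp D) (F : Finset Fact) (𝓡 : Finset Rule) : Prop :=
  (∀ f ∈ F, M.SatFact f) ∧ ∀ R ∈ 𝓡, M.SatRule R

end Interp

/-- Logical entailment `F, 𝓡 ⊨ Q`. (A domain is nonempty, since an interpretation gives values to
the constants.) -/
def Entails (F : Finset Fact) (𝓡 : Finset Rule) (Q : CQ) : Prop :=
  ∀ (D : Type) (M : Interp D), M.IsModel F 𝓡 → M.SatCQ Q

/-- `M` is a universal model of `(F, 𝓡)`. -/
def Interp.IsUniversal {D : Type} (M : Interp D) (F : Finset Fact) (𝓡 : Finset Rule) : Prop :=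
  M.IsModel F 𝓡 ∧ ∀ Q : CQ, M.SatCQ Q ↔ Entails F 𝓡 Q

/-! ### Piece-unifiers and rewritings -/

/-- Apply a map on terms to an atom. -/
def substAtom (σ : Term → Term) (a : Atom) : Atom := (a.1, a.2.map σ)

/-- Apply a map on terms to a set of atoms. -/
def subst (σ : Term → Term) (A : Finset Atom) : Finset Atom := A.image (substAtom σ)

/-- Rename the variables of a rule by `ρ`. -/
def Rule.rename (ρ : ℕ → ℕ) (R : Rule) : Rule :=
  (R.1.map (substAtom (Sum.map ρ id)), R.2.map (substAtom (Sum.map ρ id)))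

/-- `P` represents a partition of the set of terms `T`: a term outside `T` is related to itself only,
and the classes of the partition are the classes of the elements of `T`. -/
def IsPartitionOf (P : Setoid Term) (T : Set Term) : Prop :=
  ∀ t u, P t u → t = u ∨ (t ∈ T ∧ u ∈ T)

/-- No class contains two constants. -/
def Admissible (P : Setoid Term) : Prop := ∀ c d, P (cst c) (cst d) → c = d

/-- `σ` is obtained from `P` by selecting an element in each class, with priority given to constants:
it is constant on each class, its value belongs to the class, and a class that contains a
constant is sent to that constant. -/
def ObtainedFrom (σ : Term → Term) (P : Setoid Term) : Prop :=
  (∀ t u, P t u → σ t = σ u) ∧ (∀ t, P t (σ t)) ∧ ∀ c, σ (cst c) = cst c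

/-- `(Q', H', P)` is a piece-unifier of the query `Q` with the rule `R` (whose variables are assumed
not to occur in `Q`). The last clause is the condition on the classes that contain an
existential variable of `R`. -/
structure IsPieceUnifier (Q : CQ) (R : Rule) (Q' H' : Finset Atom) (P : Setoid Term) : Prop where
  subset_query : Q' ⊆ Q
  nonempty : Q'.Nonempty
  subset_head : H' ⊆ R.head
  partition : IsPartitionOf P (terms (Q' ∪ H'))
  admissible : Admissible P
  unify : ∀ σ, ObtainedFrom σ P → subst σ H' = subst σ Q'
  exist : ∀ z ∈ R.existVars, var z ∈ terms (Q' ∪ H') → ∀ t, P (var z) t → t ≠ var z →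
    ∃ x : ℕ, t = var x ∧ x ∈ vars Q' ∧ x ∉ vars (Q \ Q')

/-- `Q'` is a piece: no nonempty proper subset `Q''` of `Q'` satisfies the condition on existential
variables for the restricted partition, that is, is such that the terms of `Q''` in the
class of an existential variable do not occur in `Q \ Q''`. -/
def IsPiece (Q : CQ) (R : Rule) (Q' : Finset Atom) (P : Setoid Term) : Prop :=
  ¬ ∃ Q'' : Finset Atom, Q'' ⊂ Q' ∧ Q''.Nonempty ∧
    ∀ z ∈ R.existVars, ∀ t ∈ terms Q'', P (var z) t → t ≠ var z → t ∉ terms (Q \ Q'')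

/-- `Q₁` is a direct rewriting of `Q` with the rule `R`: for some variant `R.rename ρ` of `R` whose
variables do not occur in `Q`, and some single-piece unifier `(Q', H', P)` of `Q` with it,
`Q₁ = σ(Q \ Q') ∪ σ(B)`. -/
def DirectRewriting (R : Rule) (Q Q₁ : CQ) : Prop :=
  ∃ ρ : ℕ → ℕ, Function.Injective ρ ∧ Disjoint (R.rename ρ).vars (vars Q) ∧
    ∃ (Q' H' : Finset Atom) (P : Setoid Term) (σ : Term → Term),
      IsPieceUnifier Q (R.rename ρ) Q' H' P ∧ IsPiece Q (R.rename ρ) Q' P ∧ ObtainedFrom σ P ∧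
      Q₁ = subst σ (Q \ Q') ∪ subst σ (R.rename ρ).body

/-- `Q'` is a rewriting of `Q` with respect to `𝓡`: it is reached from `Q` by finitely many (possibly
zero) direct rewritings with rules of `𝓡`. -/
def IsRewriting (𝓡 : Finset Rule) (Q Q' : CQ) : Prop :=
  Relation.ReflTransGen (fun Q₁ Q₂ => ∃ R ∈ 𝓡, DirectRewriting R Q₁ Q₂) Q Q'

/-! ### Classes of rule sets -/

/-- Finite expansion sets: every knowledge base `(F, 𝓡)` has a finite universal model. -/
def fes : Set (Finset Rule) :=
  {𝓡 | ∀ F : Finset Fact, ∃ (D : Type) (_ : Finite D) (M : Interp D), M.IsUniversal F 𝓡}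

/-- Finite unification sets: every query `Q` has a finite set of rewritings that is complete for every
fact base. -/
def fus : Set (Finset Rule) :=
  {𝓡 | ∀ Q : CQ, ∃ S : Finset CQ, (∀ Q' ∈ S, IsRewriting 𝓡 Q Q') ∧
    ∀ F : Finset Fact, Entails F 𝓡 Q ↔ ∃ Q' ∈ S, Entails F ∅ Q'}

/-- Transitivity rules `p(x, y) ∧ p(y, z) → p(x, z)`. -/
def IsTransitivityRule (R : Rule) : Prop :=
  ∃ p x y z : ℕ, x ≠ y ∧ y ≠ z ∧ x ≠ z ∧
    R.body = {(p, [var x, var y]), (p, [var y, var z])} ∧ R.head = {(p, [var x, var z])}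

/-- `𝓒 + trans`: the rule sets obtained from a rule set of `𝓒` by adding transitivity rules. -/
def plusTrans (𝓒 : Set (Finset Rule)) : Set (Finset Rule) :=
  {𝓢 | ∃ 𝓡 ∈ 𝓒, ∃ 𝓣 : Finset Rule, (∀ R ∈ 𝓣, IsTransitivityRule R) ∧ 𝓢 = 𝓡 ∪ 𝓣}

/-! ### The decision problem -/

/-- Atomic CQ entailment over knowledge bases with rule set in `𝓒` is decidable: some algorithm, given
a knowledge base `K` with rule set in `𝓒` and an atom `q`, halts and answers whether `K ⊨ q`.
Nothing is required of the algorithm on the other inputs. -/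
def AtomicEntailmentDecidable (𝓒 : Set (Finset Rule)) : Prop :=
  ∃ f : KB × Atom →. Bool, Partrec f ∧
    ∀ (K : KB) (q : Atom), KB.ruleSet K ∈ 𝓒 →
      ∃ b ∈ f (K, q), (b = true ↔ Entails (KB.factBase K) (KB.ruleSet K) {q})

end ExRule

/-! Transitivity can restore a recursion that a rule set has been built to lack. Consider clauses
over ternary relations `T j`, possibly with existential head variables. A tuple is reified as an
object `s` marked by the unary predicate `1`, with an edge to `s` from each component, and the
components are marked by `0`. Rule bodies ask for direct edges from `0`-marked to `1`-marked
objects, whereas rule heads only create paths of length two through a fresh unmarked midpoint.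

Without transitivity such a head can never feed a body (`tuple_in_facts`), so the chase stops after
one step. The one-step chase is then a finite model, universal because it maps into every model;
this gives fes (`mem_fes`). For fus (`mem_fus`), a match of `Q` in the one-step chase is unfolded by
piece-rewritings. Each one removes a piece of atoms that are not matched to facts
(`exists_directRewriting`), so `Q.card` steps suffice whatever the fact base, and finitely many
candidates have to be kept. Rewritings are sound in every model of the rules
(`DirectRewriting.sound`).

With transitivity the paths contract to edges, so every model of the rules yields relations
satisfying the clauses (`satClause_tupleRel`). Conversely, every structure satisfying the clauses
yields a model (`encInterp_satRule`, `encInterp_satRule_trans`).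

The clauses chosen, `interpClauses`, form an interpreter for `Turing.ToPartrec.Code`. If the program
halts, its evaluation is derivable in every structure (`exists_eval`); if not, the intended
structure with an empty halting relation is a countermodel (`intended_satClause`). Hence an atomic
query expresses halting (`entails_iff_dom`). Only the facts depend on the input, so one fixed rule
set serves both classes, and a decision procedure would solve a halting problem. -/

namespace ExRule

/-! ### The one-step chase -/

/-- The elements of the one-step chase: those of `C` name the constants, and `(R, θ, z)` is the
null that instantiates the existential variable `z` of `R` in the trigger given by `θ`. Variables
are given modulo `N + 1`, where `N` bounds all variables of the rules. -/
abbrev ChaseDom (C : Type) (𝓡 : Finset Rule) (N : ℕ) : Type :=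
  C ⊕ (𝓡 × (Fin (N + 1) → C) × Fin (N + 1))

section Chase

variable {C : Type} (κ : ℕ → C) (F : Finset Fact) (𝓡 : Finset Rule) (N : ℕ)

open Classical in
/-- The value of a variable of a rule in a trigger. -/
noncomputable def trigVar (R : 𝓡) (θ : Fin (N + 1) → C) (x : ℕ) : ChaseDom C 𝓡 N :=
  if x ∈ Rule.existVars R.1 then Sum.inr (R, θ, Fin.ofNat (N + 1) x)
  else Sum.inl (θ (Fin.ofNat (N + 1) x))

/-- The value of a term of a rule in a trigger. -/
noncomputable def trigVal (R : 𝓡) (θ : Fin (N + 1) → C) : Term → ChaseDom C 𝓡 N :=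
  Sum.elim (trigVar 𝓡 N R θ) (fun c => Sum.inl (κ c))

/-- The tuple `l` belongs to the fact base. -/
def InFacts (p : ℕ) (l : List (ChaseDom C 𝓡 N)) : Prop :=
  ∃ fl : List ℕ, (p, fl) ∈ F ∧ l = fl.map (fun c => Sum.inl (κ c))

/-- The body of `R` is mapped to the fact base by `θ`. -/
def Active (R : 𝓡) (θ : Fin (N + 1) → C) : Prop :=
  ∀ a ∈ Rule.body R.1, InFacts κ F 𝓡 N a.1 (a.2.map (trigVal κ 𝓡 N R θ))

/-- The tuple `l` is in the head of `R` instantiated by the trigger `(R, θ)`. -/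
def FromTrigger (R : 𝓡) (θ : Fin (N + 1) → C) (p : ℕ) (l : List (ChaseDom C 𝓡 N)) : Prop :=
  ∃ a ∈ Rule.head R.1, a.1 = p ∧ l = a.2.map (trigVal κ 𝓡 N R θ)

/-- The fact base together with the heads of all triggers on it. -/
noncomputable def chase : Interp (ChaseDom C 𝓡 N) where
  const c := Sum.inl (κ c)
  rel p l := InFacts κ F 𝓡 N p l ∨ ∃ R θ, Active κ F 𝓡 N R θ ∧ FromTrigger κ 𝓡 N R θ p l

/-- All variables of the rules are at most `N`. -/
def VarBound : Prop := ∀ R ∈ 𝓡, ∀ x ∈ Rule.vars R, x ≤ N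

/-- The bodies of the rules are mapped into the one-step chase only through facts. -/
def BodiesInFacts : Prop :=
  ∀ R ∈ 𝓡, ∀ v : ℕ → ChaseDom C 𝓡 N, (∀ a ∈ Rule.body R, (chase κ F 𝓡 N).Holds v a) →
    ∀ a ∈ Rule.body R, InFacts κ F 𝓡 N a.1 (a.2.map ((chase κ F 𝓡 N).val v))

variable {κ F 𝓡 N}

/-- Reduction modulo `N + 1` keeps the chase domain finite without identifying variables of a rule,
so distinct existential variables of a trigger give distinct nulls. -/
theorem VarBound.ofNat_inj (hN : VarBound 𝓡 N) {R : Rule} (hR : R ∈ 𝓡) {x y : ℕ}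
    (hx : x ∈ Rule.vars R) (hy : y ∈ Rule.vars R)
    (h : Fin.ofNat (N + 1) x = Fin.ofNat (N + 1) y) : x = y := by
  have h1 := hN R hR x hx
  have h2 := hN R hR y hy
  have h3 := congrArg Fin.val h
  simp only [Fin.val_ofNat] at h3
  rwa [Nat.mod_eq_of_lt (by omega), Nat.mod_eq_of_lt (by omega)] at h3

theorem trigVar_of_mem {R : 𝓡} {θ : Fin (N + 1) → C} {x : ℕ} (h : x ∈ Rule.existVars R.1) :
    trigVar 𝓡 N R θ x = Sum.inr (R, θ, Fin.ofNat (N + 1) x) := if_pos h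

theorem trigVar_of_notMem {R : 𝓡} {θ : Fin (N + 1) → C} {x : ℕ} (h : x ∉ Rule.existVars R.1) :
    trigVar 𝓡 N R θ x = Sum.inl (θ (Fin.ofNat (N + 1) x)) := if_neg h

theorem trigVal_eq_inr {R : 𝓡} {θ : Fin (N + 1) → C} {t : Term} {n}
    (h : trigVal κ 𝓡 N R θ t = Sum.inr n) :
    ∃ x ∈ Rule.existVars R.1, t = var x ∧ n = (R, θ, Fin.ofNat (N + 1) x) := by
  rcases t with x | c
  · by_cases hx : x ∈ Rule.existVars R.1
    · refine ⟨x, hx, rfl, ?_⟩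
      change trigVar 𝓡 N R θ x = _ at h
      rw [trigVar_of_mem hx] at h
      exact (Sum.inr.inj h).symm
    · change trigVar 𝓡 N R θ x = _ at h
      rw [trigVar_of_notMem hx] at h
      cases h
  · cases h

theorem InFacts.mem_inl {p : ℕ} {l : List (ChaseDom C 𝓡 N)} (h : InFacts κ F 𝓡 N p l)
    {d : ChaseDom C 𝓡 N} (hd : d ∈ l) : ∃ f ∈ F, ∃ c ∈ f.2, d = Sum.inl (κ c) := by
  obtain ⟨fl, hf, rfl⟩ := h
  obtain ⟨c, hc, rfl⟩ := List.mem_map.1 hd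
  exact ⟨_, hf, c, hc, rfl⟩

/-- If the bodies are mapped only to facts then the one-step chase is a model. -/
theorem chase_isModel (hS : BodiesInFacts κ F 𝓡 N) (hN : VarBound 𝓡 N) :
    (chase κ F 𝓡 N).IsModel F 𝓡 := by
  refine ⟨fun f hf => Or.inl ⟨f.2, hf, rfl⟩, fun R hR v hv => ?_⟩
  have hb := hS R hR v hv
  -- The body lies in the facts, so `v` sends body variables to elements of `C`; the default `κ 0`
  -- affects only irrelevant variables. The trigger for `θ` has thus already fired.
  let θ : Fin (N + 1) → C := fun i => Sum.elim id (fun _ => κ 0) (v i.val)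
  have key : ∀ x ∈ vars R.body, trigVar 𝓡 N ⟨R, hR⟩ θ x = v x := by
    rintro x ⟨a, ha, hx⟩
    have hx' : x ∉ Rule.existVars R := fun h => h.2 ⟨a, ha, hx⟩
    rw [trigVar_of_notMem (R := ⟨R, hR⟩) hx']
    obtain ⟨f, -, c, -, hc⟩ := (hb a ha).mem_inl (List.mem_map_of_mem hx)
    have hvx : v x = Sum.inl (κ c) := hc
    have hxN : (Fin.ofNat (N + 1) x).val = x :=
      Nat.mod_eq_of_lt (Nat.lt_succ_of_le (hN R hR x (Or.inl ⟨a, ha, hx⟩)))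
    simp only [θ, hxN, hvx, Sum.elim_inl, id]
  refine ⟨trigVar 𝓡 N ⟨R, hR⟩ θ, key, fun a ha => Or.inr ⟨⟨R, hR⟩, θ, fun b hbb => ?_, a, ha, rfl, rfl⟩⟩
  have : b.2.map (trigVal κ 𝓡 N ⟨R, hR⟩ θ) = b.2.map ((chase κ F 𝓡 N).val v) := by
    refine List.map_congr_left fun t ht => ?_
    rcases t with x | c
    · exact key x ⟨b, hbb, ht⟩
    · rfl
  rw [this]
  exact hb b hbb

/-- The rules contain no constants. -/
def ConstFree (𝓡 : Finset Rule) : Prop :=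
  ∀ R ∈ 𝓡, ∀ c, cst c ∉ terms (Rule.body R) ∧ cst c ∉ terms (Rule.head R)

/-- The one-step chase maps homomorphically to every model. -/
theorem exists_hom_chase (hcf : ConstFree 𝓡) (hN : VarBound 𝓡 N) {D : Type} {M : Interp D} (hM : M.IsModel F 𝓡)
    (γ : C → D) (hγ : ∀ f ∈ F, ∀ c ∈ f.2, γ (κ c) = M.const c) :
    ∃ φ : ChaseDom C 𝓡 N → D, (∀ c, φ (Sum.inl c) = γ c) ∧
      ∀ p l, (chase κ F 𝓡 N).rel p l → M.rel p (l.map φ) := by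
  classical
  have hfact : ∀ (φ : ChaseDom C 𝓡 N → D), (∀ c, φ (Sum.inl c) = γ c) →
      ∀ p l, InFacts κ F 𝓡 N p l → M.rel p (l.map φ) := by
    rintro φ hφ p l ⟨fl, hf, rfl⟩
    have := hM.1 _ hf
    simp only [Interp.SatFact] at this
    rw [List.map_map]
    convert this using 1
    refine List.map_congr_left fun c hc => ?_
    simp only [Function.comp, hφ]
    exact hγ _ hf c hc
  -- One witness assignment in `M` is fixed per trigger, with a junk value for inactive triggers; a
  -- null goes to the value that its trigger's witness gives to its variable.
  have hex : ∀ (R : 𝓡) (θ : Fin (N + 1) → C), ∃ w : ℕ → D, Active κ F 𝓡 N R θ →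
      (∀ x ∈ vars (Rule.body R.1), w x = γ (θ (Fin.ofNat (N + 1) x))) ∧
        ∀ a ∈ Rule.head R.1, M.Holds w a := by
    intro R θ
    by_cases hA : Active κ F 𝓡 N R θ
    · obtain ⟨w, h1, h2⟩ := hM.2 R.1 R.2 (fun x => γ (θ (Fin.ofNat (N + 1) x))) (fun a ha => by
        have := hfact (Sum.elim γ (fun _ => M.const 0)) (fun _ => rfl) _ _ (hA a ha)
        rw [List.map_map] at this
        simp only [Interp.Holds]
        convert this using 1
        refine List.map_congr_left fun t ht => ?_
        rcases t with x | c
        · have hx : x ∉ Rule.existVars R.1 := fun h => h.2 ⟨a, ha, ht⟩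
          change _ = Sum.elim γ _ (trigVar 𝓡 N R θ x)
          rw [trigVar_of_notMem hx]
          rfl
        · exact ((hcf R.1 R.2 c).1 ⟨a, ha, ht⟩).elim)
      exact ⟨w, fun _ => ⟨h1, h2⟩⟩
    · exact ⟨fun _ => M.const 0, fun h => (hA h).elim⟩
  choose w hw using hex
  refine ⟨Sum.elim γ (fun n => w n.1 n.2.1 n.2.2.val), fun _ => rfl, ?_⟩
  rintro p l (h | ⟨R, θ, hA, a, ha, rfl, rfl⟩)
  · exact hfact _ (fun _ => rfl) _ _ h
  · obtain ⟨h1, h2⟩ := hw R θ hA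
    have := h2 a ha
    simp only [Interp.Holds] at this
    rw [List.map_map]
    convert this using 1
    refine List.map_congr_left fun t ht => ?_
    rcases t with x | c
    · change Sum.elim γ _ (trigVar 𝓡 N R θ x) = w R θ x
      by_cases hx : x ∈ Rule.existVars R.1
      · rw [trigVar_of_mem hx]
        have hxN : (Fin.ofNat (N + 1) x).val = x :=
          Nat.mod_eq_of_lt (Nat.lt_succ_of_le (hN R.1 R.2 x (Or.inr hx.1)))
        simp only [Sum.elim_inr, hxN]
      · rw [trigVar_of_notMem hx, h1 x (by_contra fun h => hx ⟨⟨a, ha, ht⟩, h⟩)]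
        rfl
    · exact ((hcf R.1 R.2 c).2 ⟨a, ha, ht⟩).elim

/-- Only constants of the fact base and nulls occur in the chase. -/
theorem chase_args (hcf : ConstFree 𝓡) {p : ℕ} {l : List (ChaseDom C 𝓡 N)}
    (h : (chase κ F 𝓡 N).rel p l) {c : C} (hc : Sum.inl c ∈ l) :
    ∃ f ∈ F, ∃ b ∈ f.2, c = κ b := by
  rcases h with h | ⟨R, θ, hA, a, ha, rfl, rfl⟩
  · obtain ⟨f, hf, b, hb, h⟩ := h.mem_inl hc
    exact ⟨f, hf, b, hb, Sum.inl.inj h⟩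
  · obtain ⟨t, ht, hv⟩ := List.mem_map.1 hc
    rcases t with x | d
    · by_cases hx : x ∈ Rule.existVars R.1
      · change trigVar 𝓡 N R θ x = _ at hv
        rw [trigVar_of_mem hx] at hv
        cases hv
      · obtain ⟨b, hb, hxb⟩ : x ∈ vars (Rule.body R.1) :=
          by_contra fun h => hx ⟨⟨a, ha, ht⟩, h⟩
        obtain ⟨f, hf, b, hb, h⟩ := (hA b hb).mem_inl (List.mem_map_of_mem hxb)
        exact ⟨f, hf, b, hb, Sum.inl.inj (hv.symm.trans h)⟩
    · exact ((hcf R.1 R.2 d).2 ⟨a, ha, ht⟩).elim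

end Chase

/-- A set of constant-free rules whose bodies are mapped into the one-step chase only through facts
is a finite expansion set. -/
theorem mem_fes {𝓡 : Finset Rule} {N : ℕ} (hcf : ConstFree 𝓡) (hN : VarBound 𝓡 N)
    (hS : ∀ (C : Type) (κ : ℕ → C) (F : Finset Fact), BodiesInFacts κ F 𝓡 N) : 𝓡 ∈ fes := by
  classical
  intro F
  let S : Finset ℕ := F.biUnion fun f => f.2.toFinset
  have hmem : ∀ f ∈ F, ∀ c ∈ f.2, c ∈ S := fun f hf c hc =>
    Finset.mem_biUnion.2 ⟨f, hf, List.mem_toFinset.2 hc⟩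
  -- All constants foreign to `F` collapse to `none`, which makes the domain finite. This is
  -- harmless since, by `chase_args`, `none` occurs in no tuple that holds.
  let κ : ℕ → Option S := fun c => if h : c ∈ S then some ⟨c, h⟩ else none
  refine ⟨ChaseDom (Option S) 𝓡 N, inferInstance, chase κ F 𝓡 N,
    chase_isModel (hS _ κ F) hN, fun Q => ⟨fun ⟨v, hv⟩ D M hM => ?_, fun h =>
      h _ _ (chase_isModel (hS _ κ F) hN)⟩⟩
  let γ : Option S → D := fun o => o.elim (M.const 0) (fun c => M.const c.1)
  have hγ : ∀ c ∈ S, γ (κ c) = M.const c := fun c hc => by simp [γ, κ, hc]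
  obtain ⟨φ, hφ, hrel⟩ := exists_hom_chase (κ := κ) (N := N) hcf hN hM γ
    (fun f hf c hc => hγ c (hmem f hf c hc))
  refine ⟨fun x => φ (v x), fun a ha => ?_⟩
  have h1 := hv a ha
  have := hrel _ _ h1
  rw [List.map_map] at this
  simp only [Interp.Holds]
  convert this using 1
  refine List.map_congr_left fun t ht => ?_
  rcases t with x | c
  · rfl
  · change M.const c = φ (Sum.inl (κ c))
    obtain ⟨f, hf, b, hb, hcb⟩ := chase_args hcf h1 (c := κ c) (List.mem_map.2 ⟨cst c, ht, rfl⟩)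
    have hbS := hmem f hf b hb
    have : c ∈ S := by
      by_contra hc
      simp [κ, hc, hbS] at hcb
    rw [hφ, hγ c this]


/-! ### Soundness of rewriting -/

theorem map_eq_map_of_imp {α β γ δ : Type*} {l : List α} {l' : List β} {f : α → γ} {f' : β → γ}
    {g : α → δ} {g' : β → δ} (h : l.map f = l'.map f')
    (H : ∀ t ∈ l, ∀ u ∈ l', f t = f' u → g t = g' u) : l.map g = l'.map g' := by
  induction l generalizing l' with
  | nil => cases l' with
    | nil => rfl
    | cons => cases h
  | cons a l ih => cases l' with
    | nil => cases h
    | cons b l' =>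
      simp only [List.map_cons, List.cons.injEq] at h ⊢
      exact ⟨H a (by simp) b (by simp) h.1,
        ih h.2 fun t ht u hu => H t (List.mem_cons_of_mem _ ht) u (List.mem_cons_of_mem _ hu)⟩

theorem exists_of_map_eq {α β γ : Type*} {l : List α} {l' : List β} {f : α → γ} {f' : β → γ}
    (h : l.map f = l'.map f') {t : α} (ht : t ∈ l) : ∃ u ∈ l', f' u = f t := by
  have : f t ∈ l'.map f' := h ▸ List.mem_map_of_mem ht
  exact List.mem_map.1 this

theorem Interp.holds_iff_of_val_eq {D : Type} {M : Interp D} {v w : ℕ → D} {σ : Term → Term}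
    {a : Atom} (h : ∀ t ∈ a.2, M.val w t = M.val v (σ t)) :
    M.Holds w a ↔ M.Holds v (substAtom σ a) := by
  simp only [Interp.Holds, substAtom, List.map_map]
  rw [List.map_congr_left h]
  rfl

/-- The map on terms that renames the variables by `ρ`. -/
abbrev renTerm (ρ : ℕ → ℕ) : Term → Term := Sum.map ρ id

theorem Rule.body_rename (ρ : ℕ → ℕ) (R : Rule) :
    (R.rename ρ).body = subst (renTerm ρ) R.body := by
  ext a
  simp [Rule.rename, Rule.body, subst]

theorem Rule.head_rename (ρ : ℕ → ℕ) (R : Rule) :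
    (R.rename ρ).head = subst (renTerm ρ) R.head := by
  ext a
  simp [Rule.rename, Rule.head, subst]

theorem mem_subst {σ : Term → Term} {A : Finset Atom} {b : Atom} :
    b ∈ subst σ A ↔ ∃ a ∈ A, substAtom σ a = b := Finset.mem_image

theorem vars_subst_renTerm (ρ : ℕ → ℕ) (A : Finset Atom) :
    vars (subst (renTerm ρ) A) = ρ '' vars A := by
  ext y
  constructor
  · rintro ⟨b, hb, hy⟩
    obtain ⟨a, ha, rfl⟩ := mem_subst.1 hb
    obtain ⟨t, ht, h⟩ := List.mem_map.1 hy
    rcases t with x | c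
    · exact ⟨x, ⟨a, ha, ht⟩, Sum.inl.inj h⟩
    · cases h
  · rintro ⟨x, ⟨a, ha, hx⟩, rfl⟩
    exact ⟨_, mem_subst.2 ⟨a, ha, rfl⟩, List.mem_map.2 ⟨var x, hx, rfl⟩⟩

theorem Rule.existVars_rename {ρ : ℕ → ℕ} (hρ : Function.Injective ρ) (R : Rule) :
    (R.rename ρ).existVars = ρ '' R.existVars := by
  rw [Rule.existVars, Rule.existVars, Rule.body_rename, Rule.head_rename, vars_subst_renTerm,
    vars_subst_renTerm, Set.image_sdiff hρ]

theorem Interp.SatRule.rename {D : Type} {M : Interp D} {R : Rule} (h : M.SatRule R) {ρ : ℕ → ℕ}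
    (hρ : Function.Injective ρ) : M.SatRule (R.rename ρ) := by
  intro v hv
  rw [Rule.body_rename] at hv
  obtain ⟨w, hw, hh⟩ := h (v ∘ ρ) fun a ha =>
    (Interp.holds_iff_of_val_eq (σ := renTerm ρ) (fun t _ => by rcases t with x | c <;> rfl)).2
      (hv _ (mem_subst.2 ⟨a, ha, rfl⟩))
  refine ⟨Function.extend ρ w v, ?_, ?_⟩
  · rw [Rule.body_rename, vars_subst_renTerm]
    rintro _ ⟨x, hx, rfl⟩
    rw [hρ.extend_apply]
    exact hw x hx
  · rw [Rule.head_rename]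
    intro b hb
    obtain ⟨a, ha, rfl⟩ := mem_subst.1 hb
    refine (Interp.holds_iff_of_val_eq (fun t _ => ?_)).1 (hh a ha)
    rcases t with x | c
    · exact (hρ.extend_apply w v x).symm
    · rfl

/-- A rule that holds in `M` transfers the truth of a direct rewriting to the query. -/
theorem DirectRewriting.sound {R : Rule} {Q Q₁ : CQ} (h : DirectRewriting R Q Q₁) {D : Type}
    {M : Interp D} (hR : M.SatRule R) (h₁ : M.SatCQ Q₁) : M.SatCQ Q := by
  classical
  obtain ⟨ρ, hρ, hdis, Q', H', P, σ, hU, -, ⟨hσ1, hσ2, hσ3⟩, rfl⟩ := h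
  have hR' := hR.rename hρ
  generalize R.rename ρ = R' at *
  obtain ⟨v, hv⟩ := h₁
  have hval : ∀ t, M.val (fun x => M.val v (σ (var x))) t = M.val v (σ t) := by
    rintro (x | c)
    · rfl
    · rw [hσ3]; rfl
  obtain ⟨w, hw, hh⟩ := hR' (fun x => M.val v (σ (var x))) fun a ha =>
    (Interp.holds_iff_of_val_eq (fun t _ => hval t)).2
      (hv _ (Finset.mem_union_right _ (mem_subst.2 ⟨a, ha, rfl⟩)))
  -- `E x z` says that `x` is glued to the existential variable `z`. Such an `x` takes the value
  -- that the head witness `w` gives to `z`; every other variable keeps the value read through `σ`.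
  let E : ℕ → ℕ → Prop := fun x z => z ∈ R'.existVars ∧ var z ∈ terms (Q' ∪ H') ∧ P (var z) (var x)
  refine ⟨fun x => if hx : ∃ z, E x z then w hx.choose else M.val v (σ (var x)), ?_⟩
  set v' : ℕ → D := fun x => if hx : ∃ z, E x z then w hx.choose else M.val v (σ (var x)) with hv'
  have hneg : ∀ t : Term, (∀ x, t = var x → ¬ ∃ z, E x z) → M.val v' t = M.val v (σ t) := by
    rintro (x | c) ht
    · exact dif_neg (ht x rfl)
    · rw [hσ3]; rfl
  have hQvar : ∀ x ∈ vars Q, x ∉ R'.vars := fun x hx hx' => hdis.le_bot ⟨hx', hx⟩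
  have hQ'Q : ∀ x ∈ vars Q', x ∈ vars Q := fun x ⟨a, ha, hx⟩ => ⟨a, hU.subset_query ha, hx⟩
  have hexv : ∀ z ∈ R'.existVars, z ∈ R'.vars := fun z hz => Or.inr hz.1
  intro a ha
  by_cases haQ' : a ∈ Q'
  · have hmem : substAtom σ a ∈ subst σ H' := by
      rw [hU.unify σ ⟨hσ1, hσ2, hσ3⟩]
      exact mem_subst.2 ⟨a, haQ', rfl⟩
    obtain ⟨b, hb, hab⟩ := mem_subst.1 hmem
    have hbh := hU.subset_head hb
    have hB := hh b hbh
    simp only [substAtom, Prod.mk.injEq] at hab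
    simp only [Interp.Holds] at hB ⊢
    rw [← hab.1]
    convert hB using 1
    refine map_eq_map_of_imp hab.2.symm fun t ht u hu htu => ?_
    have hPut : P u t := P.trans (hσ2 u) (by rw [← htu]; exact P.symm (hσ2 t))
    have hu' : u ∈ terms (Q' ∪ H') := ⟨b, Finset.mem_union_right _ hb, hu⟩
    have ht' : t ∈ terms Q' := ⟨a, haQ', ht⟩
    have huR : ∀ y, u = var y → y ∈ R'.vars := fun y hy => Or.inr ⟨b, hbh, hy ▸ hu⟩
    by_cases hue : ∃ z ∈ R'.existVars, u = var z
    · obtain ⟨z, hz, rfl⟩ := hue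
      have htz : t ≠ var z := by
        rintro rfl
        exact hQvar z (hQ'Q z ht') (hexv z hz)
      obtain ⟨x, rfl, hx, -⟩ := hU.exist z hz hu' t hPut htz
      have hx : ∃ z, E x z := ⟨z, hz, hu', hPut⟩
      change v' x = w z
      rw [hv']
      simp only [hx, dif_pos]
      congr 1
      -- The choice of `z` is immaterial: a class cannot contain two existential variables, as the
      -- other members of the class of `z` are variables of the query.
      by_contra hne
      obtain ⟨h1, h2, h3⟩ := hx.choose_spec
      obtain ⟨y, hy, hyQ, -⟩ := hU.exist z hz hu' (var hx.choose)
        (P.trans hPut (P.symm h3)) fun h => hne (Sum.inl.inj h)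
      exact hQvar y (hQ'Q y hyQ) (Sum.inl.inj hy ▸ hexv _ h1)
    · rw [hneg t, htu]
      · rcases u with y | c
        · have hyb : y ∈ vars R'.body := by
            by_contra hy
            exact hue ⟨y, ⟨⟨b, hbh, hu⟩, hy⟩, rfl⟩
          exact (hw y hyb).symm
        · rw [hσ3]; rfl
      · rintro x rfl ⟨z, hz, hzT, hP⟩
        have hzu : P (var z) u := P.trans hP (P.symm hPut)
        obtain ⟨y, hy, hyQ, -⟩ := hU.exist z hz hzT u hzu fun h => hue ⟨z, hz, h⟩
        exact hQvar y (hQ'Q y hyQ) (huR y hy)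
  · have haQ : a ∈ Q \ Q' := Finset.mem_sdiff.2 ⟨ha, haQ'⟩
    refine (Interp.holds_iff_of_val_eq (fun t ht => hneg t ?_)).2
      (hv _ (Finset.mem_union_left _ (mem_subst.2 ⟨a, haQ, rfl⟩)))
    -- A variable glued to an existential one does not occur outside `Q'`, so the remaining atoms
    -- keep their values.
    rintro x rfl ⟨z, hz, hzT, hP⟩
    have hxz : var x ≠ var z := fun h => hQvar x ⟨a, ha, ht⟩ (Sum.inl.inj h ▸ hexv z hz)
    obtain ⟨y, hy, -, hy'⟩ := hU.exist z hz hzT _ hP hxz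
    exact hy' (Sum.inl.inj hy ▸ ⟨a, haQ, ht⟩)

theorem IsRewriting.sound {𝓡 : Finset Rule} {Q Q' : CQ} (h : IsRewriting 𝓡 Q Q') {D : Type}
    {M : Interp D} (hM : ∀ R ∈ 𝓡, M.SatRule R) (h' : M.SatCQ Q') : M.SatCQ Q := by
  induction h with
  | refl => exact h'
  | tail _ hbc ih =>
    obtain ⟨R, hR, hd⟩ := hbc
    exact ih (hd.sound (hM R hR) h')


/-! ### Finiteness of the candidates for direct rewritings -/

theorem finite_terms (A : Finset Atom) : (terms A).Finite := by
  classical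
  refine (A.biUnion fun a => a.2.toFinset).finite_toSet.subset ?_
  rintro t ⟨a, ha, ht⟩
  exact Finset.mem_coe.2 (Finset.mem_biUnion.2 ⟨a, ha, List.mem_toFinset.2 ht⟩)

theorem finite_vars (A : Finset Atom) : (vars A).Finite :=
  (finite_terms A).preimage (Sum.inl_injective.injOn)

theorem finite_setOf_length_eq {α : Type*} {T : Set α} (hT : T.Finite) (n : ℕ) :
    {l : List α | l.length = n ∧ ∀ t ∈ l, t ∈ T}.Finite := by
  induction n with
  | zero =>
    refine (Set.finite_singleton []).subset ?_
    rintro l ⟨hl, -⟩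
    exact List.length_eq_zero_iff.1 hl
  | succ n ih =>
    refine (hT.image2 List.cons ih).subset ?_
    rintro l ⟨hl, hT'⟩
    cases l with
    | nil => cases hl
    | cons a l =>
      exact ⟨a, hT' a (by simp), l, ⟨by simpa using hl, fun t ht => hT' t (by simp [ht])⟩, rfl⟩

/-- The atoms obtained from the atoms of `A` by a map on terms with values in `T`. -/
def atomImages (A : Finset Atom) (T : Set Term) : Set Atom :=
  {b | ∃ a ∈ A, ∃ f : Term → Term, (∀ t ∈ a.2, f t ∈ T) ∧ b = substAtom f a}

theorem finite_atomImages (A : Finset Atom) {T : Set Term} (hT : T.Finite) :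
    (atomImages A T).Finite := by
  have : (⋃ a ∈ A, Prod.mk a.1 '' {l : List Term | l.length = a.2.length ∧ ∀ t ∈ l, t ∈ T}).Finite :=
    A.finite_toSet.biUnion fun a _ => (finite_setOf_length_eq hT _).image _
  refine this.subset ?_
  rintro b ⟨a, ha, f, hf, rfl⟩
  simp only [Set.mem_iUnion]
  refine ⟨a, ha, a.2.map f, ⟨by simp, ?_⟩, rfl⟩
  intro t ht
  obtain ⟨u, hu, rfl⟩ := List.mem_map.1 ht
  exact hf u hu

/-! ### Completeness of rewriting for the one-step chase -/

/-- Each admissible partition has a substitution obtained from it. -/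
theorem Admissible.exists_obtainedFrom {P : Setoid Term} (hP : Admissible P) :
    ∃ σ, ObtainedFrom σ P := by
  classical
  refine ⟨fun t => if h : ∃ c, P t (cst c) then cst h.choose else (Quotient.mk P t).out, ?_, ?_, ?_⟩
  · intro t u htu
    have hiff : ∀ c, P t (cst c) ↔ P u (cst c) := fun c =>
      ⟨fun h => P.trans (P.symm htu) h, fun h => P.trans htu h⟩
    have hq : Quotient.mk P t = Quotient.mk P u := Quotient.sound htu
    simp only [hiff, hq]
  · intro t
    dsimp only
    split_ifs with h
    · exact h.choose_spec
    · exact P.symm (Quotient.mk_out t)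
  · intro c
    have h : ∃ d, P (cst c) (cst d) := ⟨c, P.refl _⟩
    dsimp only
    rw [dif_pos h]
    exact congrArg cst (hP _ _ h.choose_spec).symm

section Step

variable {F : Finset Fact} {𝓡 : Finset Rule} {N : ℕ}

open Classical in
/-- The atoms of `Q` that `h` does not map to facts. -/
noncomputable def nonFacts (F : Finset Fact) (𝓡 : Finset Rule) (N : ℕ) (Q : CQ)
    (h : ℕ → ChaseDom ℕ 𝓡 N) : Finset Atom :=
  Q.filter fun a => ¬ InFacts id F 𝓡 N a.1 (a.2.map ((chase id F 𝓡 N).val h))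

/-- The atoms of `Q` together with those of the variants of the rules. -/
def stepAtoms (𝓡 : Finset Rule) (K : ℕ) (Q : CQ) : Finset Atom :=
  Q ∪ 𝓡.biUnion fun R => (R.rename (· + K)).body ∪ (R.rename (· + K)).head

theorem fromTrigger_inr {C : Type} {κ : ℕ → C} {R : 𝓡} {θ} {p : ℕ} {l : List (ChaseDom C 𝓡 N)}
    (h : FromTrigger κ 𝓡 N R θ p l) {n} (hn : Sum.inr n ∈ l) :
    ∃ x ∈ Rule.existVars R.1, n = (R, θ, Fin.ofNat (N + 1) x) := by
  obtain ⟨a, -, -, rfl⟩ := h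
  obtain ⟨t, -, ht⟩ := List.mem_map.1 hn
  obtain ⟨x, hx, -, h⟩ := trigVal_eq_inr ht
  exact ⟨x, hx, h⟩

/-- A homomorphism from `Q` to the chase that does not map all atoms to facts factors through a
direct rewriting of `Q` in which fewer atoms are not mapped to facts. -/
theorem exists_directRewriting (hN : VarBound 𝓡 N) {Q : CQ} {K : ℕ}
    (hK : ∀ x ∈ vars Q, x < K) {h : ℕ → ChaseDom ℕ 𝓡 N}
    (hh : ∀ a ∈ Q, (chase id F 𝓡 N).Holds h a) (hne : (nonFacts F 𝓡 N Q h).Nonempty) :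
    ∃ R ∈ 𝓡, ∃ Q₁, DirectRewriting R Q Q₁ ∧
      (∀ a ∈ Q₁, a ∈ atomImages (stepAtoms 𝓡 K Q) (terms (stepAtoms 𝓡 K Q))) ∧
      ∃ g : ℕ → ChaseDom ℕ 𝓡 N, (∀ a ∈ Q₁, (chase id F 𝓡 N).Holds g a) ∧
        (nonFacts F 𝓡 N Q₁ g).card < (nonFacts F 𝓡 N Q h).card := by
  classical
  set M := chase id F 𝓡 N with hMdef
  obtain ⟨a₀, ha₀⟩ := hne
  obtain ⟨ha₀Q, ha₀F⟩ := Finset.mem_filter.1 ha₀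
  obtain ⟨R, θ, hA, hT₀⟩ := (hh a₀ ha₀Q).resolve_left ha₀F
  -- All non-fact atoms of `Q` produced by the trigger of `a₀`. A set is `Closed` when it shares no
  -- null-valued term with the rest of `Q`.
  let QT : Finset Atom := (nonFacts F 𝓡 N Q h).filter fun a =>
    FromTrigger id 𝓡 N R θ a.1 (a.2.map (M.val h))
  let Closed : Finset Atom → Prop := fun X =>
    ∀ t ∈ terms X, (∃ n, M.val h t = Sum.inr n) → t ∉ terms (Q \ X)
  have hQTQ : QT ⊆ Q := fun a ha => (Finset.mem_filter.1 (Finset.mem_filter.1 ha).1).1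
  have hQTnull : ∀ t ∈ terms QT, ∀ n, M.val h t = Sum.inr n →
      ∃ x ∈ Rule.existVars R.1, n = (R, θ, Fin.ofNat (N + 1) x) := by
    rintro t ⟨a, ha, ht⟩ n hn
    exact fromTrigger_inr (Finset.mem_filter.1 ha).2 (hn ▸ List.mem_map_of_mem ht)
  -- A null records the trigger that created it, so two non-fact atoms sharing a null come from the
  -- same trigger.
  have hQTclosed : Closed QT := by
    rintro t htT ⟨n, hn⟩ ⟨a, ha, hta⟩
    obtain ⟨x, hx, rfl⟩ := hQTnull t htT n hn
    obtain ⟨haQ, haT⟩ := Finset.mem_sdiff.1 ha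
    have hmem : Sum.inr (R, θ, Fin.ofNat (N + 1) x) ∈ a.2.map (M.val h) :=
      hn ▸ List.mem_map_of_mem hta
    have hnf : ¬ InFacts id F 𝓡 N a.1 (a.2.map (M.val h)) := fun hf => by
      obtain ⟨_, _, _, _, h⟩ := hf.mem_inl hmem
      cases h
    obtain ⟨R', θ', -, hT'⟩ := (hh a haQ).resolve_left hnf
    obtain ⟨y, -, hy⟩ := fromTrigger_inr hT' hmem
    simp only [Prod.mk.injEq] at hy
    obtain ⟨rfl, rfl, -⟩ := hy
    exact haT (Finset.mem_filter.2 ⟨Finset.mem_filter.2 ⟨haQ, hnf⟩, hT'⟩)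
  -- A minimal nonempty closed subset; minimality will make it a single piece.
  obtain ⟨Q', ⟨hQ'T, hQ'ne, hQ'cl⟩, hmin⟩ :=
    (wellFounded_lt : WellFounded ((· < ·) : Finset Atom → Finset Atom → Prop)).has_min
      {X | X ⊆ QT ∧ X.Nonempty ∧ Closed X}
      ⟨QT, subset_rfl, ⟨a₀, Finset.mem_filter.2 ⟨ha₀, hT₀⟩⟩, hQTclosed⟩
  have hQ'Q : Q' ⊆ Q := hQ'T.trans hQTQ
  let ρ : ℕ → ℕ := (· + K)
  have hρ : Function.Injective ρ := fun x y h => Nat.add_right_cancel h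
  -- Variables below `K` belong to `Q`, and the shifted variant of the rule uses those from `K` on,
  -- so `g` combines `h` with the trigger.
  let g : ℕ → ChaseDom ℕ 𝓡 N := fun y => if y < K then h y else trigVar 𝓡 N R θ (y - K)
  have hgQ : ∀ t ∈ terms Q, M.val g t = M.val h t := by
    rintro (x | c) ht
    · exact if_pos (hK x ht)
    · rfl
  have hgR : ∀ t, M.val g (renTerm ρ t) = trigVal id 𝓡 N R θ t := by
    rintro (x | c)
    · change (if x + K < K then _ else trigVar 𝓡 N R θ (x + K - K)) = _
      rw [if_neg (by omega), Nat.add_sub_cancel]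
      rfl
    · rfl
  have hQatom : ∀ a ∈ Q, a.2.map (M.val g) = a.2.map (M.val h) := fun a ha =>
    List.map_congr_left fun t ht => hgQ t ⟨a, ha, ht⟩
  have hRatom : ∀ a : Atom, (substAtom (renTerm ρ) a).2.map (M.val g) =
      a.2.map (trigVal id 𝓡 N R θ) := fun a => by
    simp only [substAtom, List.map_map]
    exact List.map_congr_left fun t _ => hgR t
  let H' : Finset Atom := (Rule.rename ρ R.1).head.filter fun b =>
    ∃ a ∈ Q', b.1 = a.1 ∧ b.2.map (M.val g) = a.2.map (M.val g)
  have hH' : ∀ a ∈ Q', ∃ b ∈ H', b.1 = a.1 ∧ b.2.map (M.val g) = a.2.map (M.val g) := by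
    intro a ha
    obtain ⟨b, hb, hb1, hb2⟩ := (Finset.mem_filter.1 (hQ'T ha)).2
    have h2 : (substAtom (renTerm ρ) b).2.map (M.val g) = a.2.map (M.val g) := by
      rw [hRatom, hQatom a (hQ'Q ha), hb2]
    refine ⟨substAtom (renTerm ρ) b, Finset.mem_filter.2 ⟨?_, a, ha, hb1, h2⟩, hb1, h2⟩
    rw [Rule.head_rename]
    exact mem_subst.2 ⟨b, hb, rfl⟩
  have hhead : ∀ t ∈ terms (Rule.rename ρ R.1).head, ∀ n, M.val g t = Sum.inr n →
      ∃ x ∈ Rule.existVars R.1, t = var (ρ x) ∧ n = (R, θ, Fin.ofNat (N + 1) x) := by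
    rintro t ⟨b, hb, ht⟩ n hn
    rw [Rule.head_rename] at hb
    obtain ⟨a, ha, rfl⟩ := mem_subst.1 hb
    obtain ⟨u, hu, rfl⟩ := List.mem_map.1 ht
    rw [hgR] at hn
    obtain ⟨x, hx, rfl, hx'⟩ := trigVal_eq_inr hn
    exact ⟨x, hx, rfl, hx'⟩
  -- Terms of `Q' ∪ H'` are identified exactly when `g` gives them the same value. Hence `g` is
  -- unchanged by `σ` and still matches the rewritten query.
  let P : Setoid Term :=
    { r := fun t u => t = u ∨
        (t ∈ terms (Q' ∪ H') ∧ u ∈ terms (Q' ∪ H') ∧ M.val g t = M.val g u)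
      iseqv := by
        refine ⟨fun _ => Or.inl rfl, ?_, ?_⟩
        · rintro t u (rfl | ⟨h1, h2, h3⟩)
          · exact Or.inl rfl
          · exact Or.inr ⟨h2, h1, h3.symm⟩
        · rintro t u s (rfl | ⟨h1, h2, h3⟩) (rfl | ⟨h4, h5, h6⟩)
          · exact Or.inl rfl
          · exact Or.inr ⟨h4, h5, h6⟩
          · exact Or.inr ⟨h1, h2, h3⟩
          · exact Or.inr ⟨h1, h5, h3.trans h6⟩ }
  have hPval : ∀ t u, P t u → M.val g t = M.val g u := by
    rintro t u (rfl | ⟨-, -, h3⟩)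
    · rfl
    · exact h3
  have hadm : Admissible P := fun c d hcd => Sum.inl.inj (hPval _ _ hcd)
  have hterms : terms (Q' ∪ H') ⊆ terms (stepAtoms 𝓡 K Q) := by
    rintro t ⟨a, ha, ht⟩
    refine ⟨a, ?_, ht⟩
    rcases Finset.mem_union.1 ha with ha | ha
    · exact Finset.mem_union_left _ (hQ'Q ha)
    · exact Finset.mem_union_right _ (Finset.mem_biUnion.2
        ⟨R.1, R.2, Finset.mem_union_right _ (Finset.mem_filter.1 ha).1⟩)
  obtain ⟨σ, hσ⟩ := hadm.exists_obtainedFrom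
  have hσval : ∀ t, M.val g (σ t) = M.val g t := fun t => (hPval _ _ (hσ.2.1 t)).symm
  have hσterms : ∀ t ∈ terms (stepAtoms 𝓡 K Q), σ t ∈ terms (stepAtoms 𝓡 K Q) := by
    intro t ht
    rcases hσ.2.1 t with he | ⟨-, h2, -⟩
    · rwa [← he]
    · exact hterms h2
  have hσatom : ∀ a : Atom, (substAtom σ a).2.map (M.val g) = a.2.map (M.val g) := fun a => by
    simp only [substAtom, List.map_map]
    exact List.map_congr_left fun t _ => hσval t
  have hdis : Disjoint (Rule.rename ρ R.1).vars (vars Q) := by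
    rw [Set.disjoint_left, Rule.vars, Rule.body_rename, Rule.head_rename, vars_subst_renTerm,
      vars_subst_renTerm, ← Set.image_union]
    rintro _ ⟨x, -, rfl⟩ hx
    have := hK _ hx
    simp only [ρ] at this
    omega
  have hunif : IsPieceUnifier Q (Rule.rename ρ R.1) Q' H' P := by
    refine ⟨hQ'Q, hQ'ne, Finset.filter_subset _ _, ?_, hadm, ?_, ?_⟩
    · rintro t u (rfl | ⟨h1, h2, -⟩)
      · exact Or.inl rfl
      · exact Or.inr ⟨h1, h2⟩
    · intro τ hτ
      have key : ∀ a ∈ Q', ∀ b ∈ H', b.1 = a.1 → b.2.map (M.val g) = a.2.map (M.val g) →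
          substAtom τ b = substAtom τ a := by
        intro a ha b hb h1 h2
        refine Prod.ext h1 (map_eq_map_of_imp h2 fun t ht u hu htu => hτ.1 _ _ (Or.inr
          ⟨⟨b, Finset.mem_union_right _ hb, ht⟩, ⟨a, Finset.mem_union_left _ ha, hu⟩, htu⟩))
      ext c
      constructor
      · intro hc
        obtain ⟨b, hb, rfl⟩ := mem_subst.1 hc
        obtain ⟨a, ha, h1, h2⟩ := (Finset.mem_filter.1 hb).2
        exact mem_subst.2 ⟨a, ha, (key a ha b hb h1 h2).symm⟩
      · intro hc
        obtain ⟨a, ha, rfl⟩ := mem_subst.1 hc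
        obtain ⟨b, hb, h1, h2⟩ := hH' a ha
        exact mem_subst.2 ⟨b, hb, key a ha b hb h1 h2⟩
    · intro z hz hzT t hzt htz
      rw [Rule.existVars_rename hρ] at hz
      obtain ⟨z, hz, rfl⟩ := hz
      have hgz : M.val g (var (ρ z)) = Sum.inr (R, θ, Fin.ofNat (N + 1) z) :=
        (hgR (var z)).trans (trigVar_of_mem hz)
      obtain ⟨-, ⟨a, ha, hta⟩, hzv⟩ := hzt.resolve_left fun h => htz h.symm
      rw [hgz] at hzv
      rcases Finset.mem_union.1 ha with ha | ha
      · have hhv : M.val h t = Sum.inr (R, θ, Fin.ofNat (N + 1) z) :=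
          (hgQ t ⟨a, hQ'Q ha, hta⟩).symm.trans hzv.symm
        have hcl := hQ'cl t ⟨a, ha, hta⟩ ⟨_, hhv⟩
        rcases t with x | c
        · exact ⟨x, rfl, ⟨a, ha, hta⟩, hcl⟩
        · cases hhv
      · obtain ⟨x, hx, rfl, hxz⟩ :=
          hhead t ⟨a, (Finset.mem_filter.1 ha).1, hta⟩ _ hzv.symm
        simp only [Prod.mk.injEq, true_and] at hxz
        exact absurd (by rw [hN.ofNat_inj R.2 (Or.inr hx.1) (Or.inr hz.1) hxz.symm]) htz
  have hpiece : IsPiece Q (Rule.rename ρ R.1) Q' P := by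
    rintro ⟨Q'', hss, hne'', hcond⟩
    -- A null-valued term of `Q''` has the value of an existential variable of the head, so it lies
    -- in the class of that variable. The condition refuting `IsPiece` thus makes `Q''` closed,
    -- against minimality.
    refine hmin Q'' ⟨hss.subset.trans hQ'T, hne'', ?_⟩ hss
    rintro t ⟨a, ha, hta⟩ ⟨n, hn⟩
    have haQ' := hss.subset ha
    obtain ⟨b, hb, h1, h2⟩ := hH' a haQ'
    obtain ⟨u, hu, hut⟩ := exists_of_map_eq h2.symm hta
    have htQ : t ∈ terms Q := ⟨a, hQ'Q haQ', hta⟩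
    have hgt : M.val g u = Sum.inr n := by rw [hut, hgQ t htQ, hn]
    obtain ⟨x, hx, rfl, -⟩ := hhead u ⟨b, (Finset.mem_filter.1 hb).1, hu⟩ n hgt
    refine hcond (ρ x) (by rw [Rule.existVars_rename hρ]; exact ⟨x, hx, rfl⟩) t ⟨a, ha, hta⟩
      (Or.inr ⟨⟨b, Finset.mem_union_right _ hb, hu⟩, ⟨a, Finset.mem_union_left _ haQ', hta⟩, hut⟩) ?_
    rintro rfl
    have := hK _ htQ
    simp only [ρ] at this
    omega
  have hbody : ∀ b ∈ (Rule.rename ρ R.1).body, InFacts id F 𝓡 N b.1 (b.2.map (M.val g)) := by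
    intro b hb
    rw [Rule.body_rename] at hb
    obtain ⟨a, ha, rfl⟩ := mem_subst.1 hb
    rw [hRatom]
    exact hA a ha
  refine ⟨R.1, R.2, _, ⟨ρ, hρ, hdis, Q', H', P, σ, hunif, hpiece, hσ, rfl⟩, ?_, g, ?_, ?_⟩
  · intro c hc
    obtain ⟨a, ha, rfl⟩ : ∃ a ∈ stepAtoms 𝓡 K Q, substAtom σ a = c := by
      rcases Finset.mem_union.1 hc with hc | hc
      · obtain ⟨a, ha, rfl⟩ := mem_subst.1 hc
        exact ⟨a, Finset.mem_union_left _ (Finset.mem_sdiff.1 ha).1, rfl⟩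
      · obtain ⟨a, ha, rfl⟩ := mem_subst.1 hc
        exact ⟨a, Finset.mem_union_right _ (Finset.mem_biUnion.2
          ⟨R.1, R.2, Finset.mem_union_left _ ha⟩), rfl⟩
    exact ⟨a, ha, σ, fun t ht => hσterms t ⟨a, ha, ht⟩, rfl⟩
  · intro c hc
    rcases Finset.mem_union.1 hc with hc | hc
    · obtain ⟨a, ha, rfl⟩ := mem_subst.1 hc
      have haQ := (Finset.mem_sdiff.1 ha).1
      have := hh a haQ
      simp only [Interp.Holds] at this ⊢
      rw [hσatom, hQatom a haQ]
      exact this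
    · obtain ⟨a, ha, rfl⟩ := mem_subst.1 hc
      simp only [Interp.Holds]
      rw [hσatom]
      exact Or.inl (hbody a ha)
  · have hQ'nf : Q' ⊆ nonFacts F 𝓡 N Q h := fun a ha => (Finset.mem_filter.1 (hQ'T ha)).1
    -- The new body atoms are matched to facts, so the non-fact atoms of the rewriting all come from
    -- those of `Q` outside the nonempty `Q'`.
    have hsub : nonFacts F 𝓡 N (subst σ (Q \ Q') ∪ subst σ (Rule.rename ρ R.1).body) g ⊆
        (nonFacts F 𝓡 N Q h \ Q').image (substAtom σ) := by
      intro c hc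
      obtain ⟨hc, hcF⟩ := Finset.mem_filter.1 hc
      rcases Finset.mem_union.1 hc with hc | hc
      · obtain ⟨a, ha, rfl⟩ := mem_subst.1 hc
        obtain ⟨haQ, haQ'⟩ := Finset.mem_sdiff.1 ha
        refine Finset.mem_image.2 ⟨a, Finset.mem_sdiff.2 ⟨Finset.mem_filter.2 ⟨haQ, ?_⟩, haQ'⟩, rfl⟩
        change ¬ InFacts id F 𝓡 N a.1 ((substAtom σ a).2.map (M.val g)) at hcF
        rwa [hσatom, hQatom a haQ] at hcF
      · obtain ⟨a, ha, rfl⟩ := mem_subst.1 hc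
        change ¬ InFacts id F 𝓡 N a.1 ((substAtom σ a).2.map (M.val g)) at hcF
        rw [hσatom] at hcF
        exact (hcF (hbody a ha)).elim
    refine ((Finset.card_le_card hsub).trans Finset.card_image_le).trans_lt ?_
    refine Finset.card_lt_card ⟨Finset.sdiff_subset, fun hle => ?_⟩
    obtain ⟨a, ha⟩ := hQ'ne
    exact (Finset.mem_sdiff.1 (hle (hQ'nf ha))).2 ha

/-- A query all of whose atoms are mapped to facts is entailed by the fact base. -/
theorem entails_of_nonFacts_eq_empty {Q : CQ} {h : ℕ → ChaseDom ℕ 𝓡 N}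
    (he : nonFacts F 𝓡 N Q h = ∅) : Entails F ∅ Q := by
  classical
  intro D I hI
  let ψ : ChaseDom ℕ 𝓡 N → D := Sum.elim I.const fun _ => I.const 0
  refine ⟨fun x => ψ (h x), fun a ha => ?_⟩
  have hf : InFacts id F 𝓡 N a.1 (a.2.map ((chase id F 𝓡 N).val h)) := by
    by_contra hf
    have : a ∈ nonFacts F 𝓡 N Q h := Finset.mem_filter.2 ⟨ha, hf⟩
    rw [he] at this
    exact absurd this (Finset.notMem_empty a)
  obtain ⟨fl, hfl, hl⟩ := hf
  have h1 := hI.1 _ hfl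
  have h2 : a.2.map (I.val fun x => ψ (h x)) = (a.2.map ((chase id F 𝓡 N).val h)).map ψ := by
    rw [List.map_map]
    refine List.map_congr_left fun t _ => ?_
    rcases t with x | c <;> rfl
  simp only [Interp.Holds]
  rw [h2, hl, List.map_map]
  exact h1

/-- `S` is chosen before `F`, which is the uniformity that fus demands. The induction is on the
number of atoms still to be unfolded. Fixing the shift `K` confines the useful direct rewritings to
subsets of the finite set `atomImages`, whatever `F` and `h` are. -/
theorem exists_finite_rewritings (hN : VarBound 𝓡 N) (k : ℕ) (Q : CQ) :
    ∃ S : Finset CQ, (∀ Q' ∈ S, IsRewriting 𝓡 Q Q') ∧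
      ∀ (F : Finset Fact) (h : ℕ → ChaseDom ℕ 𝓡 N), (∀ a ∈ Q, (chase id F 𝓡 N).Holds h a) →
        (nonFacts F 𝓡 N Q h).card ≤ k → ∃ Q' ∈ S, Entails F ∅ Q' := by
  classical
  induction k generalizing Q with
  | zero =>
    refine ⟨{Q}, fun Q' hQ' => ?_, fun F h _ hk => ⟨Q, by simp, ?_⟩⟩
    · rw [Finset.mem_singleton.1 hQ']
      exact Relation.ReflTransGen.refl
    · exact entails_of_nonFacts_eq_empty (Finset.card_eq_zero.1 (Nat.le_zero.1 hk))
  | succ k ih =>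
    choose S hS1 hS2 using ih
    obtain ⟨K, hK⟩ : ∃ K, ∀ x ∈ vars Q, x < K := by
      obtain ⟨K, hK⟩ := (finite_vars Q).bddAbove
      exact ⟨K + 1, fun x hx => Nat.lt_succ_of_le (hK hx)⟩
    have hfin := finite_atomImages (stepAtoms 𝓡 K Q) (finite_terms (stepAtoms 𝓡 K Q))
    refine ⟨{Q} ∪ (hfin.toFinset.powerset.filter fun Q₁ => ∃ R ∈ 𝓡, DirectRewriting R Q Q₁).biUnion S,
      ?_, fun F h hh hk => ?_⟩
    · intro Q' hQ'
      rcases Finset.mem_union.1 hQ' with hQ' | hQ'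
      · rw [Finset.mem_singleton.1 hQ']
        exact Relation.ReflTransGen.refl
      · obtain ⟨Q₁, h1, h2⟩ := Finset.mem_biUnion.1 hQ'
        exact Relation.ReflTransGen.head (Finset.mem_filter.1 h1).2 (hS1 Q₁ Q' h2)
    · rcases (nonFacts F 𝓡 N Q h).eq_empty_or_nonempty with he | hne
      · exact ⟨Q, by simp, entails_of_nonFacts_eq_empty he⟩
      · obtain ⟨R, hR, Q₁, hd, hat, g, hg, hlt⟩ := exists_directRewriting hN hK hh hne
        obtain ⟨Q', hQ', hE⟩ := hS2 Q₁ F g hg (by omega)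
        refine ⟨Q', Finset.mem_union_right _ (Finset.mem_biUnion.2 ⟨Q₁, Finset.mem_filter.2
          ⟨Finset.mem_powerset.2 fun a ha => hfin.mem_toFinset.2 (hat a ha), R, hR, hd⟩, hQ'⟩), hE⟩

end Step

/-- A set of rules whose bodies are mapped into the one-step chase only through facts is a finite
unification set. -/
theorem mem_fus {𝓡 : Finset Rule} {N : ℕ} (hN : VarBound 𝓡 N)
    (hS : ∀ F : Finset Fact, BodiesInFacts id F 𝓡 N) : 𝓡 ∈ fus := by
  classical
  intro Q
  -- At most all `Q.card` atoms are matched outside the facts.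
  obtain ⟨S, h1, h2⟩ := exists_finite_rewritings hN Q.card Q
  refine ⟨S, h1, fun F => ⟨fun hE => ?_, ?_⟩⟩
  · obtain ⟨h, hh⟩ := hE _ _ (chase_isModel (hS F) hN)
    exact h2 F h hh (Finset.card_le_card fun a ha => (Finset.mem_filter.1 ha).1)
  · rintro ⟨Q', hQ', hE⟩ D M hM
    exact (h1 Q' hQ').sound hM.2 (hE D M ⟨hM.1, fun R hR => absurd hR (Finset.notMem_empty R)⟩)


/-! ### Clauses over ternary relations and their delayed encoding -/

/-- An atom `T j x y z` over the ternary relation with number `j` and variables `x`, `y`, `z`. -/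
abbrev HAtom := ℕ × ℕ × ℕ × ℕ

/-- A clause: a list of body atoms and a head atom. Head variables that do not occur in the body are
existentially quantified. -/
abbrev Clause := List HAtom × HAtom

/-- The variables of the body of a clause. -/
def Clause.bodyVars (cl : Clause) : List ℕ := cl.1.flatMap fun α => [α.2.1, α.2.2.1, α.2.2.2]

/-- A family of ternary relations satisfies a clause. -/
def SatClause {A : Type} (T : ℕ → A → A → A → Prop) (cl : Clause) : Prop :=
  ∀ v : ℕ → A, (∀ α ∈ cl.1, T α.1 (v α.2.1) (v α.2.2.1) (v α.2.2.2)) →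
    ∃ w : ℕ → A, (∀ x ∈ cl.bodyVars, w x = v x) ∧
      T cl.2.1 (w cl.2.2.1) (w cl.2.2.2.1) (w cl.2.2.2.2)

/-- The tuple `T j x y z` is represented by an object `s` that is marked by the unary predicate `1`
and linked to its components, which are marked by the unary predicate `0`. -/
def tupleAtoms {α : Type} (j : ℕ) (x y z s : α) : List (ℕ × List α) :=
  [(1, [s]), (0, [x]), (0, [y]), (0, [z]), (3 * j, [x, s]), (3 * j + 1, [y, s]),
    (3 * j + 2, [z, s])]

theorem mem_tupleAtoms {α : Type} {j : ℕ} {x y z s : α} {a : ℕ × List α} :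
    a ∈ tupleAtoms j x y z s ↔ a = (1, [s]) ∨ a = (0, [x]) ∨ a = (0, [y]) ∨ a = (0, [z]) ∨
      a = (3 * j, [x, s]) ∨ a = (3 * j + 1, [y, s]) ∨ a = (3 * j + 2, [z, s]) := by
  simp [tupleAtoms]

theorem tupleAtoms_map {α β : Type} (f : α → β) (j : ℕ) (x y z s : α) {b : ℕ × List β} :
    b ∈ tupleAtoms j (f x) (f y) (f z) (f s) ↔
      ∃ a ∈ tupleAtoms j x y z s, (a.1, a.2.map f) = b := by
  simp [tupleAtoms, eq_comm]

/-- The variable that stands for the variable `x` of a clause. -/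
abbrev regVar (x : ℕ) : Term := var (3 * x)

/-- The variable that stands for the object that represents the atom `α`. -/
abbrev sinkVar (α : HAtom) : Term := var (3 * Encodable.encode α + 1)

/-- The body of the rule that encodes a clause. -/
def Clause.ruleBody (cl : Clause) : List Atom :=
  cl.1.flatMap fun α =>
    tupleAtoms α.1 (regVar α.2.1) (regVar α.2.2.1) (regVar α.2.2.2) (sinkVar α)

/-- The head of the rule that encodes a clause: the object that represents the head atom is linked to
the components by paths of length two. -/
def Clause.ruleHead (cl : Clause) : List Atom :=
  [(1, [var 5]),
    (3 * cl.2.1, [regVar cl.2.2.1, var 2]), (3 * cl.2.1, [var 2, var 5]),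
    (3 * cl.2.1 + 1, [regVar cl.2.2.2.1, var 2]), (3 * cl.2.1 + 1, [var 2, var 5]),
    (3 * cl.2.1 + 2, [regVar cl.2.2.2.2, var 2]), (3 * cl.2.1 + 2, [var 2, var 5])] ++
  -- Components from the body already carry the mark `0`; a mark `0` produced by a trigger therefore
  -- always falls on a null.
  ([cl.2.2.1, cl.2.2.2.1, cl.2.2.2.2].filter fun x => x ∉ cl.bodyVars).map fun x => (0, [regVar x])

/-- The rule that encodes a clause. -/
def Clause.rule (cl : Clause) : Rule := (cl.ruleBody, cl.ruleHead)

/-- The transitivity rule for the binary predicate `p`. -/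
def transRule (p : ℕ) : Rule :=
  ([(p, [var 0, var 1]), (p, [var 1, var 2])], [(p, [var 0, var 2])])

/-- The transitivity rules for the predicates in the head of the encoding of a clause. -/
def Clause.transRules (cl : Clause) : List Rule :=
  [transRule (3 * cl.2.1), transRule (3 * cl.2.1 + 1), transRule (3 * cl.2.1 + 2)]

theorem isTransitivityRule_transRule (p : ℕ) : IsTransitivityRule (transRule p) :=
  ⟨p, 0, 1, 2, by simp, by simp, by simp, by simp [transRule, Rule.body], by
    simp [transRule, Rule.head]⟩

/-! ### The encoded rules form a finite expansion set and a finite unification set -/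

section Encoding

variable {cl : Clause}

theorem Clause.mem_body {a : Atom} : a ∈ Rule.body cl.rule ↔ ∃ α ∈ cl.1,
    a ∈ tupleAtoms α.1 (regVar α.2.1) (regVar α.2.2.1) (regVar α.2.2.2) (sinkVar α) := by
  simp [Rule.body, Clause.rule, Clause.ruleBody]

theorem Clause.mem_head {a : Atom} : a ∈ Rule.head cl.rule ↔ a ∈ cl.ruleHead := by
  simp [Rule.head, Clause.rule]

/-- Residues modulo 3 separate the rule variables: 0 for clause variables, 1 for the objects
representing body atoms. Residue 2 is left for the midpoint `var 2` and the new representing object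
`var 5`, which are therefore existential. -/
theorem Clause.mem_vars_body {y : ℕ} (hy : y ∈ vars (Rule.body cl.rule)) :
    (∃ x ∈ cl.bodyVars, y = 3 * x) ∨ ∃ n, y = 3 * n + 1 := by
  obtain ⟨a, ha, hy⟩ := hy
  obtain ⟨α, hα, ha⟩ := Clause.mem_body.1 ha
  have h1 : ∀ x ∈ [α.2.1, α.2.2.1, α.2.2.2], x ∈ cl.bodyVars := fun x hx =>
    List.mem_flatMap.2 ⟨α, hα, hx⟩
  simp only [List.mem_cons, List.not_mem_nil, or_false, forall_eq_or_imp, forall_eq] at h1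
  obtain ⟨hx1, hx2, hx3⟩ := h1
  have key : y = 3 * Encodable.encode α + 1 ∨ y = 3 * α.2.1 ∨ y = 3 * α.2.2.1 ∨
      y = 3 * α.2.2.2 := by
    rcases mem_tupleAtoms.1 ha with rfl | rfl | rfl | rfl | rfl | rfl | rfl <;>
      simp only [List.mem_cons, List.not_mem_nil, or_false, Sum.inl.injEq] at hy <;> omega
  rcases key with h | h | h | h
  · exact Or.inr ⟨_, h⟩
  · exact Or.inl ⟨_, hx1, h⟩
  · exact Or.inl ⟨_, hx2, h⟩
  · exact Or.inl ⟨_, hx3, h⟩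

theorem Clause.mem_existVars_of_mod_two {y : ℕ} (h : y ∈ vars (Rule.head cl.rule))
    (hy : y % 3 = 2) : y ∈ Rule.existVars cl.rule := by
  refine ⟨h, fun hb => ?_⟩
  rcases Clause.mem_vars_body hb with ⟨x, -, rfl⟩ | ⟨n, rfl⟩ <;> omega

theorem Clause.mem_existVars_of_notMem {x : ℕ} (h : 3 * x ∈ vars (Rule.head cl.rule))
    (hx : x ∉ cl.bodyVars) : 3 * x ∈ Rule.existVars cl.rule := by
  refine ⟨h, fun hb => ?_⟩
  rcases Clause.mem_vars_body hb with ⟨y, hy, h⟩ | ⟨n, h⟩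
  · exact hx (by rwa [Nat.eq_of_mul_eq_mul_left (by norm_num) h])
  · omega

theorem Clause.head_reg {t : Term} (h : (0, [t]) ∈ Rule.head cl.rule) :
    ∃ x, t = regVar x ∧ 3 * x ∈ Rule.existVars cl.rule := by
  have h' := Clause.mem_head.1 h
  simp only [Clause.ruleHead, List.mem_append, List.mem_cons, Prod.mk.injEq, List.cons.injEq,
    List.not_mem_nil, or_false, List.mem_map, List.mem_filter, decide_eq_true_eq, and_true,
    reduceCtorEq, and_false, true_and] at h'
  rcases h' with ⟨h0, -⟩ | ⟨x, ⟨-, hx⟩, rfl⟩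
  · cases h0
  · exact ⟨x, rfl, Clause.mem_existVars_of_notMem ⟨_, h, by simp⟩ hx⟩

theorem Clause.head_sink {t : Term} (h : (1, [t]) ∈ Rule.head cl.rule) :
    t = var 5 ∧ 5 ∈ Rule.existVars cl.rule := by
  have h' := Clause.mem_head.1 h
  simp [Clause.ruleHead] at h'
  subst h'
  exact ⟨rfl, Clause.mem_existVars_of_mod_two ⟨_, h, by simp⟩ rfl⟩

/-- Every edge of the head has the unmarked midpoint `var 2` at one end; this is what delays the new
tuple. -/
theorem Clause.head_edge {p : ℕ} {s t : Term} (h : (p, [s, t]) ∈ Rule.head cl.rule) :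
    (t = var 2 ∧ 2 ∈ Rule.existVars cl.rule) ∨
      (s = var 2 ∧ t = var 5 ∧ 2 ∈ Rule.existVars cl.rule ∧ 5 ∈ Rule.existVars cl.rule) := by
  have h' := Clause.mem_head.1 h
  have h2 : s = var 2 ∧ t = var 5 ∨ t = var 2 := by
    rcases List.mem_append.1 h' with h' | h'
    · simp only [List.mem_cons, Prod.mk.injEq, List.cons.injEq, List.not_mem_nil, or_false,
        reduceCtorEq, and_false, and_true, false_or] at h'
      rcases h' with ⟨-, -, h⟩ | ⟨-, h⟩ | ⟨-, -, h⟩ | ⟨-, h⟩ | ⟨-, -, h⟩ | ⟨-, h⟩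
      exacts [Or.inr h, Or.inl h, Or.inr h, Or.inl h, Or.inr h, Or.inl h]
    · simp at h'
  rcases h2 with ⟨rfl, rfl⟩ | rfl
  · exact Or.inr ⟨rfl, rfl, Clause.mem_existVars_of_mod_two ⟨_, h, by simp⟩ rfl,
      Clause.mem_existVars_of_mod_two ⟨_, h, by simp⟩ rfl⟩
  · exact Or.inl ⟨rfl, Clause.mem_existVars_of_mod_two ⟨_, h, by simp⟩ rfl⟩

/-- The rules that encode the clauses of a list. -/
def clauseRules (cls : List Clause) : Finset Rule := (cls.map Clause.rule).toFinset

theorem mem_clauseRules {cls : List Clause} {R : Rule} :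
    R ∈ clauseRules cls ↔ ∃ cl ∈ cls, cl.rule = R := by
  simp [clauseRules]

variable {cls : List Clause} {C : Type} {κ : ℕ → C} {F : Finset Fact} {N : ℕ}

/-- The midpoint of a trigger bears neither mark, so no edge created by a trigger joins a `0`-marked
element to a `1`-marked one. -/
theorem tuple_in_facts (hN : VarBound (clauseRules cls) N) {p : ℕ}
    {u v : ChaseDom C (clauseRules cls) N}
    (hu : (chase κ F (clauseRules cls) N).rel 0 [u])
    (hv : (chase κ F (clauseRules cls) N).rel 1 [v])
    (huv : (chase κ F (clauseRules cls) N).rel p [u, v]) :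
    InFacts κ F (clauseRules cls) N 0 [u] ∧ InFacts κ F (clauseRules cls) N 1 [v] ∧
      InFacts κ F (clauseRules cls) N p [u, v] := by
  have hreg : ∀ {R θ d}, FromTrigger κ (clauseRules cls) N R θ 0 [d] →
      ∃ x ∈ Rule.existVars R.1, x % 3 = 0 ∧ d = Sum.inr (R, θ, Fin.ofNat (N + 1) x) := by
    rintro ⟨R, hR⟩ θ d ⟨⟨q, l⟩, ha, rfl, hl⟩
    obtain ⟨cl, -, rfl⟩ := mem_clauseRules.1 hR
    match l, hl with
    | [t], hl =>
      obtain ⟨x, rfl, hx⟩ := Clause.head_reg ha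
      refine ⟨3 * x, hx, by omega, ?_⟩
      rw [← trigVar_of_mem (R := ⟨cl.rule, hR⟩) hx]
      exact (List.cons.inj hl).1
  have hsink : ∀ {R θ d}, FromTrigger κ (clauseRules cls) N R θ 1 [d] →
      5 ∈ Rule.existVars R.1 ∧ d = Sum.inr (R, θ, Fin.ofNat (N + 1) 5) := by
    rintro ⟨R, hR⟩ θ d ⟨⟨q, l⟩, ha, rfl, hl⟩
    obtain ⟨cl, -, rfl⟩ := mem_clauseRules.1 hR
    match l, hl with
    | [t], hl =>
      obtain ⟨rfl, hx⟩ := Clause.head_sink ha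
      refine ⟨hx, ?_⟩
      rw [← trigVar_of_mem (R := ⟨cl.rule, hR⟩) hx]
      exact (List.cons.inj hl).1
  have hedge : ∀ {R θ d e}, FromTrigger κ (clauseRules cls) N R θ p [d, e] →
      (2 ∈ Rule.existVars R.1 ∧ e = Sum.inr (R, θ, Fin.ofNat (N + 1) 2)) ∨
      (2 ∈ Rule.existVars R.1 ∧ d = Sum.inr (R, θ, Fin.ofNat (N + 1) 2) ∧
        e = Sum.inr (R, θ, Fin.ofNat (N + 1) 5)) := by
    rintro ⟨R, hR⟩ θ d e ⟨⟨q, l⟩, ha, rfl, hl⟩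
    obtain ⟨cl, -, rfl⟩ := mem_clauseRules.1 hR
    match l, hl with
    | [s, t], hl =>
      obtain ⟨hd, he⟩ := List.cons.inj hl
      have he := (List.cons.inj he).1
      rcases Clause.head_edge ha with ⟨rfl, h2⟩ | ⟨rfl, rfl, h2, h5⟩
      · refine Or.inl ⟨h2, ?_⟩
        rw [← trigVar_of_mem (R := ⟨cl.rule, hR⟩) h2]
        exact he
      · refine Or.inr ⟨h2, ?_, ?_⟩
        · rw [← trigVar_of_mem (R := ⟨cl.rule, hR⟩) h2]
          exact hd
        · rw [← trigVar_of_mem (R := ⟨cl.rule, hR⟩) h5]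
          exact he
  have hinl : ∀ {q l d}, InFacts κ F (clauseRules cls) N q l → d ∈ l → ∃ c, d = Sum.inl c :=
    fun h hd => by
      obtain ⟨_, _, c, _, h⟩ := h.mem_inl hd
      exact ⟨_, h⟩
  rcases hv with hv | ⟨R, θ, -, hv⟩
  · obtain ⟨c, rfl⟩ := hinl hv (d := v) (by simp)
    rcases huv with huv | ⟨R, θ, -, huv⟩
    · obtain ⟨d, rfl⟩ := hinl huv (d := u) (by simp)
      rcases hu with hu | ⟨R, θ, -, hu⟩
      · exact ⟨hu, hv, huv⟩
      · obtain ⟨x, -, -, h⟩ := hreg hu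
        cases h
    · rcases hedge huv with ⟨-, h⟩ | ⟨-, -, h⟩ <;> cases h
  -- Now `v` is a new representing object, so the edge comes from a trigger. Either `v` would be a
  -- midpoint, giving `5 = 2`, or `u` is one, and its mark `0` would make 2 a multiple of 3.
  · obtain ⟨h5, rfl⟩ := hsink hv
    rcases huv with huv | ⟨R', θ', -, huv⟩
    · obtain ⟨c, h⟩ := hinl huv (d := Sum.inr (R, θ, Fin.ofNat (N + 1) 5)) (by simp)
      cases h
    · rcases hedge huv with ⟨h2, h⟩ | ⟨h2, rfl, h⟩
      · simp only [Sum.inr.injEq, Prod.mk.injEq] at h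
        obtain ⟨rfl, -, h⟩ := h
        have := hN.ofNat_inj R.2 (Or.inr h5.1) (Or.inr h2.1) h
        omega
      · rcases hu with hu | ⟨R'', θ'', -, hu⟩
        · obtain ⟨c, h⟩ := hinl hu (d := Sum.inr (R', θ', Fin.ofNat (N + 1) 2)) (by simp)
          cases h
        · obtain ⟨x, hx, hx3, h⟩ := hreg hu
          simp only [Sum.inr.injEq, Prod.mk.injEq] at h
          obtain ⟨rfl, -, h⟩ := h
          have := hN.ofNat_inj R'.2 (Or.inr h2.1) (Or.inr hx.1) h
          omega

theorem bodiesInFacts_clauseRules (hN : VarBound (clauseRules cls) N) :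
    BodiesInFacts κ F (clauseRules cls) N := by
  intro R hR v hv
  obtain ⟨cl, -, rfl⟩ := mem_clauseRules.1 hR
  intro a ha
  obtain ⟨α, hα, ha⟩ := Clause.mem_body.1 ha
  have h : ∀ b ∈ tupleAtoms α.1 (regVar α.2.1) (regVar α.2.2.1) (regVar α.2.2.2) (sinkVar α),
      (chase κ F (clauseRules cls) N).Holds v b := fun b hb => hv b (Clause.mem_body.2 ⟨α, hα, hb⟩)
  simp only [mem_tupleAtoms, forall_eq_or_imp, forall_eq] at h
  obtain ⟨hs, hx, hy, hz, hxs, hys, hzs⟩ := h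
  obtain ⟨hx, hs', hxs⟩ := tuple_in_facts hN hx hs hxs
  obtain ⟨hy, -, hys⟩ := tuple_in_facts hN hy hs hys
  obtain ⟨hz, -, hzs⟩ := tuple_in_facts hN hz hs hzs
  rcases mem_tupleAtoms.1 ha with rfl | rfl | rfl | rfl | rfl | rfl | rfl <;> assumption

theorem constFree_clauseRules : ConstFree (clauseRules cls) := by
  intro R hR c
  obtain ⟨cl, -, rfl⟩ := mem_clauseRules.1 hR
  constructor
  · rintro ⟨a, ha, hc⟩
    obtain ⟨α, hα, ha⟩ := Clause.mem_body.1 ha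
    rcases mem_tupleAtoms.1 ha with rfl | rfl | rfl | rfl | rfl | rfl | rfl <;> simp at hc
  · rintro ⟨a, ha, hc⟩
    have ha := Clause.mem_head.1 ha
    simp only [Clause.ruleHead, List.mem_append, List.mem_cons, List.not_mem_nil, or_false,
      List.mem_map] at ha
    rcases ha with (rfl | rfl | rfl | rfl | rfl | rfl | rfl) | ⟨x, -, rfl⟩ <;> simp at hc

theorem exists_varBound (𝓡 : Finset Rule) : ∃ N, VarBound 𝓡 N := by
  have : (⋃ R ∈ 𝓡, Rule.vars R).Finite := 𝓡.finite_toSet.biUnion fun R _ =>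
    (finite_vars _).union (finite_vars _)
  obtain ⟨N, hN⟩ := this.bddAbove
  exact ⟨N, fun R hR x hx => hN (Set.mem_biUnion hR hx)⟩

theorem clauseRules_mem_fes (cls : List Clause) : clauseRules cls ∈ fes := by
  obtain ⟨N, hN⟩ := exists_varBound (clauseRules cls)
  exact mem_fes constFree_clauseRules hN fun _ _ _ => bodiesInFacts_clauseRules hN

theorem clauseRules_mem_fus (cls : List Clause) : clauseRules cls ∈ fus := by
  obtain ⟨N, hN⟩ := exists_varBound (clauseRules cls)
  exact mem_fus hN fun _ => bodiesInFacts_clauseRules hN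

/-- The rules that encode a list of clauses together with the transitivity rules. -/
def allRules (cls : List Clause) : List Rule :=
  cls.map Clause.rule ++ cls.flatMap Clause.transRules

theorem allRules_mem_plusTrans {𝓒 : Set (Finset Rule)} {cls : List Clause}
    (h : clauseRules cls ∈ 𝓒) : (allRules cls).toFinset ∈ plusTrans 𝓒 := by
  refine ⟨_, h, (cls.flatMap Clause.transRules).toFinset, ?_, by simp [allRules, clauseRules]⟩
  intro R hR
  obtain ⟨cl, -, hR⟩ := List.mem_flatMap.1 (List.mem_toFinset.1 hR)
  simp only [Clause.transRules, List.mem_cons, List.not_mem_nil, or_false] at hR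
  rcases hR with rfl | rfl | rfl <;> exact isTransitivityRule_transRule _

end Encoding

/-! ### Models of the encoded rules and of the clauses -/

/-- The ternary relations encoded in an interpretation. -/
def tupleRel {D : Type} (M : Interp D) (j : ℕ) (x y z : D) : Prop :=
  ∃ s, ∀ a ∈ tupleAtoms j x y z s, M.rel a.1 a.2

theorem Interp.SatRule.trans {D : Type} {M : Interp D} {p : ℕ} (h : M.SatRule (transRule p))
    {a b c : D} (hab : M.rel p [a, b]) (hbc : M.rel p [b, c]) : M.rel p [a, c] := by
  obtain ⟨w, hw, hh⟩ := h (fun n => if n = 0 then a else if n = 1 then b else c) (by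
    simpa [transRule, Rule.body, Interp.Holds, Interp.val] using ⟨hab, hbc⟩)
  have h0 := hw 0 ⟨_, List.mem_toFinset.2 (List.mem_cons_self ..), by simp⟩
  have h2 := hw 2 ⟨(p, [var 1, var 2]), by simp [transRule, Rule.body], by simp⟩
  simpa [transRule, Rule.head, Interp.Holds, Interp.val, h0, h2] using hh

/-- The relations encoded in a model of the rule and of the transitivity rules satisfy the clause. -/
theorem satClause_tupleRel {D : Type} {M : Interp D} {cl : Clause} (hR : M.SatRule cl.rule)
    (hT : ∀ R ∈ cl.transRules, M.SatRule R) : SatClause (tupleRel M) cl := by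
  classical
  intro v hv
  have hs : ∀ α : HAtom, ∃ s, α ∈ cl.1 →
      ∀ a ∈ tupleAtoms α.1 (v α.2.1) (v α.2.2.1) (v α.2.2.2) s, M.rel a.1 a.2 := by
    intro α
    by_cases hα : α ∈ cl.1
    · obtain ⟨s, hs⟩ := hv α hα
      exact ⟨s, fun _ => hs⟩
    · exact ⟨M.const 0, fun h => (hα h).elim⟩
  choose s hs using hs
  -- Undoes the numbering of the body variables: multiples of 3 are clause variables, and the
  -- residue 1 carries the code of an atom.
  let u : ℕ → D := fun y => if y % 3 = 0 then v (y / 3) else s (Denumerable.ofNat HAtom (y / 3))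
  have hu0 : ∀ x, M.val u (regVar x) = v x := fun x => by
    simp [u, Interp.val]
  have hu1 : ∀ α, M.val u (sinkVar α) = s α := fun α => by
    have h1 : (3 * Encodable.encode α + 1) % 3 = 1 := by omega
    have h2 : (3 * Encodable.encode α + 1) / 3 = Encodable.encode α := by omega
    change (if (3 * Encodable.encode α + 1) % 3 = 0 then _ else _) = _
    rw [h1, h2, if_neg (by norm_num), Denumerable.ofNat_encode]
  obtain ⟨w, hw, hh⟩ := hR u (by
    intro a ha
    obtain ⟨α, hα, ha⟩ := Clause.mem_body.1 ha
    refine hs α hα (a.1, a.2.map (M.val u)) ?_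
    rw [← hu0, ← hu0, ← hu0, ← hu1, tupleAtoms_map (M.val u)]
    exact ⟨a, ha, rfl⟩)
  have hwv : ∀ x ∈ cl.bodyVars, w (3 * x) = v x ∧ M.rel 0 [v x] := by
    intro x hx
    obtain ⟨α, hα, hx⟩ := List.mem_flatMap.1 hx
    have hmem : (0, [regVar x]) ∈
        tupleAtoms α.1 (regVar α.2.1) (regVar α.2.2.1) (regVar α.2.2.2) (sinkVar α) := by
      simp only [List.mem_cons, List.not_mem_nil, or_false] at hx
      rcases hx with rfl | rfl | rfl <;> simp [tupleAtoms]
    refine ⟨(hw _ ⟨_, Clause.mem_body.2 ⟨α, hα, hmem⟩, by simp⟩).trans (hu0 x), ?_⟩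
    refine hs α hα (0, [v x]) ?_
    rw [← hu0, ← hu0, ← hu0, ← hu1, tupleAtoms_map (M.val u)]
    exact ⟨_, hmem, by rw [← hu0]; rfl⟩
  -- The mark of a component of the head comes from the body if its variable occurs there, and from
  -- the head otherwise.
  have hreg : ∀ x ∈ [cl.2.2.1, cl.2.2.2.1, cl.2.2.2.2], M.rel 0 [w (3 * x)] := by
    intro x hx
    by_cases hxb : x ∈ cl.bodyVars
    · rw [(hwv x hxb).1]
      exact (hwv x hxb).2
    · exact hh (0, [regVar x]) (Clause.mem_head.2 (List.mem_append_right _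
        (List.mem_map.2 ⟨x, List.mem_filter.2 ⟨hx, by simpa using hxb⟩, rfl⟩)))
  have hhead : ∀ a ∈ cl.ruleHead, M.Holds w a := fun a ha => hh a (Clause.mem_head.2 ha)
  simp only [Clause.ruleHead, List.mem_append, or_imp, forall_and, List.mem_cons, List.not_mem_nil,
    false_imp_iff, and_true, forall_eq] at hhead
  obtain ⟨⟨h5, hx2, h25x, hy2, h25y, hz2, h25z⟩, -⟩ := hhead
  simp only [Clause.transRules, List.mem_cons, List.not_mem_nil, or_false, forall_eq_or_imp,
    forall_eq] at hT
  simp only [List.mem_cons, List.not_mem_nil, or_false, forall_eq_or_imp, forall_eq] at hreg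
  refine ⟨fun x => w (3 * x), fun x hx => (hwv x hx).1, w 5, ?_⟩
  simp only [mem_tupleAtoms, forall_eq_or_imp, forall_eq]
  exact ⟨h5, hreg.1, hreg.2.1, hreg.2.2, hT.1.trans hx2 h25x, hT.2.1.trans hy2 h25y,
    hT.2.2.trans hz2 h25z⟩

/-- The elements of the interpretation that encodes a family of ternary relations: to each tuple
there correspond an intermediate object `(false, t)` and a representing object `(true, t)`. -/
abbrev EncDom (A : Type) : Type := A ⊕ (Bool × (ℕ × A × A × A))

/-- The predicate `p` gives the component `u` of the tuple `t`. -/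
def IsComponent {A : Type} (p : ℕ) (t : ℕ × A × A × A) (u : A) : Prop :=
  (p = 3 * t.1 ∧ u = t.2.1) ∨ (p = 3 * t.1 + 1 ∧ u = t.2.2.1) ∨ (p = 3 * t.1 + 2 ∧ u = t.2.2.2)

/-- The interpretation of the predicates that encodes a family of ternary relations. -/
def encRel {A : Type} (T : ℕ → A → A → A → Prop) (p : ℕ) : List (EncDom A) → Prop
  | [d] => (p = 0 ∧ ∃ a, d = Sum.inl a) ∨ (p = 1 ∧ ∃ t, d = Sum.inr (true, t))
  | [d, e] => ∃ t u, T t.1 t.2.1 t.2.2.1 t.2.2.2 ∧ IsComponent p t u ∧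
      ((d = Sum.inl u ∧ (e = Sum.inr (false, t) ∨ e = Sum.inr (true, t))) ∨
        (d = Sum.inr (false, t) ∧ e = Sum.inr (true, t)))
  | _ => False

/-- The interpretation that encodes a family of ternary relations. -/
def encInterp {A : Type} (T : ℕ → A → A → A → Prop) (ι : ℕ → EncDom A) : Interp (EncDom A) where
  const := ι
  rel := encRel T

section EncInterp

variable {A : Type} {T : ℕ → A → A → A → Prop} {ι : ℕ → EncDom A}

theorem encRel_tupleAtoms {j : ℕ} {x y z : A} (h : T j x y z) :
    ∀ a ∈ tupleAtoms j (Sum.inl x) (Sum.inl y) (Sum.inl z) (Sum.inr (true, (j, x, y, z))),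
      encRel T a.1 a.2 := by
  simp only [mem_tupleAtoms, forall_eq_or_imp, forall_eq]
  refine ⟨Or.inr ⟨rfl, _, rfl⟩, Or.inl ⟨rfl, _, rfl⟩, Or.inl ⟨rfl, _, rfl⟩, Or.inl ⟨rfl, _, rfl⟩,
    ⟨_, x, h, Or.inl ⟨rfl, rfl⟩, Or.inl ⟨rfl, Or.inr rfl⟩⟩,
    ⟨_, y, h, Or.inr (Or.inl ⟨rfl, rfl⟩), Or.inl ⟨rfl, Or.inr rfl⟩⟩,
    ⟨_, z, h, Or.inr (Or.inr ⟨rfl, rfl⟩), Or.inl ⟨rfl, Or.inr rfl⟩⟩⟩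

theorem encRel_edge {p : ℕ} {d s : EncDom A} (hd : encRel T 0 [d]) (hs : encRel T 1 [s])
    (h : encRel T p [d, s]) : ∃ t u, s = Sum.inr (true, t) ∧ d = Sum.inl u ∧
      T t.1 t.2.1 t.2.2.1 t.2.2.2 ∧ IsComponent p t u := by
  obtain ⟨t, u, hT, hc, ⟨rfl, rfl | rfl⟩ | ⟨rfl, rfl⟩⟩ := h
  · simp [encRel] at hs
  · exact ⟨t, u, rfl, rfl, hT, hc⟩
  · simp [encRel] at hd

/-- The representing object stores its whole tuple, so the three edges refer to the same tuple; the
predicate name `3 * j + k` determines both `j` and the position. -/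
theorem tupleRel_encInterp {j : ℕ} {x y z : EncDom A} (h : tupleRel (encInterp T ι) j x y z) :
    ∃ a b c, x = Sum.inl a ∧ y = Sum.inl b ∧ z = Sum.inl c ∧ T j a b c := by
  obtain ⟨s, h⟩ := h
  simp only [mem_tupleAtoms, forall_eq_or_imp, forall_eq] at h
  obtain ⟨hs, hx, hy, hz, hxs, hys, hzs⟩ := h
  obtain ⟨t, a, rfl, rfl, hT, h1⟩ := encRel_edge hx hs hxs
  obtain ⟨t', b, ht, rfl, -, h2⟩ := encRel_edge hy hs hys
  obtain rfl : t = t' := by simpa using ht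
  obtain ⟨t', c, ht, rfl, -, h3⟩ := encRel_edge hz hs hzs
  obtain rfl : t = t' := by simpa using ht
  obtain ⟨j', a', b', c'⟩ := t
  refine ⟨a, b, c, rfl, rfl, rfl, ?_⟩
  simp only [IsComponent] at h1 h2 h3 hT
  obtain rfl : j' = j := by omega
  obtain rfl : a = a' := by
    rcases h1 with ⟨-, h⟩ | ⟨h, -⟩ | ⟨h, -⟩ <;> [exact h; omega; omega]
  obtain rfl : b = b' := by
    rcases h2 with ⟨h, -⟩ | ⟨-, h⟩ | ⟨h, -⟩ <;> [omega; exact h; omega]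
  obtain rfl : c = c' := by
    rcases h3 with ⟨h, -⟩ | ⟨h, -⟩ | ⟨-, h⟩ <;> [omega; omega; exact h]
  exact hT

/-- The only composable edges run from a component to the midpoint and on to the representing object
of one tuple, and `encRel` already contains the shortcut. -/
theorem encInterp_satRule_trans (p : ℕ) : (encInterp T ι).SatRule (transRule p) := by
  intro v hv
  refine ⟨v, fun _ _ => rfl, ?_⟩
  simp only [transRule, Rule.body, Rule.head, List.mem_toFinset, List.mem_cons, List.not_mem_nil,
    or_false, forall_eq_or_imp, forall_eq] at hv ⊢
  obtain ⟨⟨t, u, hT, hc, h1⟩, ⟨t', u', hT', hc', h2⟩⟩ := hv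
  refine ⟨t, u, hT, hc, ?_⟩
  rcases h1 with ⟨h1, h1' | h1'⟩ | ⟨h1, h1'⟩ <;> rcases h2 with ⟨h2, h2'⟩ | ⟨h2, h2'⟩ <;>
    rw [h1'] at h2 <;> simp only [Sum.inr.injEq, Prod.mk.injEq, reduceCtorEq, false_and,
      true_and] at h2
  exact Or.inl ⟨h1, Or.inr (by rw [h2', h2])⟩

/-- If the relations satisfy the clause, then the interpretation that encodes them satisfies the rule
that encodes the clause. -/
theorem encInterp_satRule [Inhabited A] {cl : Clause} (h : SatClause T cl) :
    (encInterp T ι).SatRule cl.rule := by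
  classical
  intro v hv
  let f : ℕ → A := fun x => Sum.elim id (fun _ => default) (v (3 * x))
  have hα : ∀ α ∈ cl.1, ∃ a b c, v (3 * α.2.1) = Sum.inl a ∧ v (3 * α.2.2.1) = Sum.inl b ∧
      v (3 * α.2.2.2) = Sum.inl c ∧ T α.1 a b c := by
    intro α hα
    refine tupleRel_encInterp (ι := ι) ⟨v (3 * Encodable.encode α + 1), fun b hb => ?_⟩
    obtain ⟨a, ha, rfl⟩ := (tupleAtoms_map ((encInterp T ι).val v) α.1 (regVar α.2.1)
      (regVar α.2.2.1) (regVar α.2.2.2) (sinkVar α)).1 hb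
    exact hv a (Clause.mem_body.2 ⟨α, hα, ha⟩)
  have hf : ∀ x ∈ cl.bodyVars, v (3 * x) = Sum.inl (f x) := by
    intro x hx
    obtain ⟨α, hα', hx⟩ := List.mem_flatMap.1 hx
    obtain ⟨a, b, c, ha, hb, hc, -⟩ := hα α hα'
    simp only [List.mem_cons, List.not_mem_nil, or_false] at hx
    rcases hx with rfl | rfl | rfl
    · simp [f, ha]
    · simp [f, hb]
    · simp [f, hc]
  obtain ⟨g, hg, hT⟩ := h f fun α hα' => by
    obtain ⟨a, b, c, ha, hb, hc, hT⟩ := hα α hα'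
    simpa [f, ha, hb, hc] using hT
  set t : ℕ × A × A × A := (cl.2.1, g cl.2.2.1, g cl.2.2.2.1, g cl.2.2.2.2) with ht
  -- The values of `v` are kept on body variables; the two fresh head variables go to the midpoint
  -- and the representing object of the derived tuple `t`.
  let w : ℕ → EncDom A := fun y =>
    if y % 3 = 0 then (if y / 3 ∈ cl.bodyVars then v y else Sum.inl (g (y / 3)))
    else if y % 3 = 1 then v y
    else if y = 2 then Sum.inr (false, t) else Sum.inr (true, t)
  have hw : ∀ x, w (3 * x) = Sum.inl (g x) := by
    intro x
    simp only [w, Nat.mul_mod_right, if_true, Nat.mul_div_cancel_left x (by norm_num : 0 < 3)]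
    split_ifs with hx
    · rw [hf x hx, hg x hx]
    · rfl
  have hw2 : w 2 = Sum.inr (false, t) := by simp [w]
  have hw5 : w 5 = Sum.inr (true, t) := by simp [w]
  refine ⟨w, ?_, fun a ha => ?_⟩
  · intro y hy
    rcases Clause.mem_vars_body hy with ⟨x, hx, rfl⟩ | ⟨n, rfl⟩
    · rw [hw, hf x hx, hg x hx]
    · have h1 : (3 * n + 1) % 3 = 1 := by omega
      simp [w, h1]
  · have ha := Clause.mem_head.1 ha
    simp only [Clause.ruleHead, List.mem_append, List.mem_cons, List.not_mem_nil, or_false,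
      List.mem_map] at ha
    have hreg : ∀ x, (encInterp T ι).val w (regVar x) = Sum.inl (g x) := hw
    have hv2 : (encInterp T ι).val w (var 2) = Sum.inr (false, t) := hw2
    have hv5 : (encInterp T ι).val w (var 5) = Sum.inr (true, t) := hw5
    rcases ha with (rfl | rfl | rfl | rfl | rfl | rfl | rfl) | ⟨x, -, rfl⟩ <;>
      simp only [Interp.Holds, List.map_cons, List.map_nil, hreg, hv2, hv5]
    · exact Or.inr ⟨rfl, _, rfl⟩
    · exact ⟨t, _, hT, Or.inl ⟨rfl, rfl⟩, Or.inl ⟨rfl, Or.inl rfl⟩⟩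
    · exact ⟨t, _, hT, Or.inl ⟨rfl, rfl⟩, Or.inr ⟨rfl, rfl⟩⟩
    · exact ⟨t, _, hT, Or.inr (Or.inl ⟨rfl, rfl⟩), Or.inl ⟨rfl, Or.inl rfl⟩⟩
    · exact ⟨t, _, hT, Or.inr (Or.inl ⟨rfl, rfl⟩), Or.inr ⟨rfl, rfl⟩⟩
    · exact ⟨t, _, hT, Or.inr (Or.inr ⟨rfl, rfl⟩), Or.inl ⟨rfl, Or.inl rfl⟩⟩
    · exact ⟨t, _, hT, Or.inr (Or.inr ⟨rfl, rfl⟩), Or.inr ⟨rfl, rfl⟩⟩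
    · exact Or.inl ⟨rfl, _, rfl⟩

end EncInterp

/-! ### Entailment from encoded knowledge bases -/

/-- A ternary fact `(j, x, y, z)` together with the constant that represents it. -/
abbrev HFact := ℕ × ℕ × ℕ × ℕ × ℕ

/-- The facts that encode a ternary fact. -/
def HFact.facts (φ : HFact) : List Fact := tupleAtoms φ.1 φ.2.1 φ.2.2.1 φ.2.2.2.1 φ.2.2.2.2

/-- The knowledge base that encodes ternary facts and clauses. -/
def encKB (φs : List HFact) (cls : List Clause) : KB := (φs.flatMap HFact.facts, allRules cls)

/-- The atomic query that asks for a tuple in the ternary relation `j`. -/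
def tupleQuery (j : ℕ) : Atom := (3 * j, [var 0, var 1])

/-- In any model of the knowledge base, the relations `tupleRel` satisfy the clauses and the ternary
facts, and a tuple in relation `j` supplies the edge the query asks for. -/
theorem entails_encKB {φs : List HFact} {cls : List Clause} {j : ℕ}
    (h : ∀ (D : Type) (const : ℕ → D) (T : ℕ → D → D → D → Prop), (∀ cl ∈ cls, SatClause T cl) →
      (∀ φ ∈ φs, T φ.1 (const φ.2.1) (const φ.2.2.1) (const φ.2.2.2.1)) → ∃ x y z, T j x y z) :
    Entails (encKB φs cls).factBase (encKB φs cls).ruleSet {tupleQuery j} := by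
  intro D M hM
  have hrule : ∀ R ∈ allRules cls, M.SatRule R := fun R hR => hM.2 R (List.mem_toFinset.2 hR)
  obtain ⟨x, y, z, s, hs⟩ := h D M.const (tupleRel M)
    (fun cl hcl => satClause_tupleRel
      (hrule _ (List.mem_append_left _ (List.mem_map_of_mem hcl)))
      (fun R hR => hrule R (List.mem_append_right _ (List.mem_flatMap.2 ⟨cl, hcl, hR⟩))))
    (fun φ hφ => ⟨M.const φ.2.2.2.2, fun b hb => by
      obtain ⟨a, ha, rfl⟩ := (tupleAtoms_map M.const _ _ _ _ _).1 hb
      exact hM.1 a (List.mem_toFinset.2 (List.mem_flatMap.2 ⟨φ, hφ, ha⟩))⟩)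
  refine ⟨fun n => if n = 0 then x else s, fun a ha => ?_⟩
  rw [Finset.mem_singleton.1 ha]
  exact hs (3 * j, [x, s]) (by simp [tupleAtoms])

/-- The encoding of the structure is a countermodel. The query asks for no marks, but even an edge
to or from a midpoint exists in `encRel` only for a tuple that is in `T`. -/
theorem not_entails_encKB {φs : List HFact} {cls : List Clause} {j : ℕ} {A : Type} [Inhabited A]
    {T : ℕ → A → A → A → Prop} {ι : ℕ → EncDom A} (hT : ∀ cl ∈ cls, SatClause T cl)
    (hφ : ∀ φ ∈ φs, ∃ a b c, ι φ.2.1 = Sum.inl a ∧ ι φ.2.2.1 = Sum.inl b ∧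
      ι φ.2.2.2.1 = Sum.inl c ∧ ι φ.2.2.2.2 = Sum.inr (true, (φ.1, a, b, c)) ∧ T φ.1 a b c)
    (hj : ∀ a b c, ¬ T j a b c) :
    ¬ Entails (encKB φs cls).factBase (encKB φs cls).ruleSet {tupleQuery j} := by
  intro hE
  have hM : (encInterp T ι).IsModel (encKB φs cls).factBase (encKB φs cls).ruleSet := by
    refine ⟨fun f hf => ?_, fun R hR => ?_⟩
    · obtain ⟨φ, hmem, hf⟩ := List.mem_flatMap.1 (List.mem_toFinset.1 hf)
      obtain ⟨a, b, c, ha, hb, hc, hs, hTφ⟩ := hφ φ hmem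
      refine encRel_tupleAtoms hTφ (f.1, f.2.map ι) ?_
      rw [← ha, ← hb, ← hc, ← hs, tupleAtoms_map ι]
      exact ⟨f, hf, rfl⟩
    · rcases List.mem_append.1 (List.mem_toFinset.1 hR) with hR | hR
      · obtain ⟨cl, hcl, rfl⟩ := List.mem_map.1 hR
        exact encInterp_satRule (hT cl hcl)
      · obtain ⟨cl, -, hR⟩ := List.mem_flatMap.1 hR
        simp only [Clause.transRules, List.mem_cons, List.not_mem_nil, or_false] at hR
        rcases hR with rfl | rfl | rfl <;> exact encInterp_satRule_trans _
  obtain ⟨v, hv⟩ := hE _ (encInterp T ι) hM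
  obtain ⟨t, u, hTt, hc, -⟩ := hv (tupleQuery j) (Finset.mem_singleton_self _)
  have : t.1 = j := by
    simp only [IsComponent, tupleQuery] at hc
    omega
  exact hj _ _ _ (this ▸ hTt)


open Turing.ToPartrec (Code)

/-! ### An interpreter for `Turing.ToPartrec.Code` by clauses -/

/-- The ternary relations are `0`: pairing; `1`: generated data; `2`: the empty list, which is also
the number zero; `3`: head and tail; `4`: evaluation of a program; `5`: program and input;
`6`: the program halts; `7`–`13`: the shapes of a program and its components. -/
def interpClauses : List Clause :=
  -- The only clause that invents an element: any two data have a pair.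
  [([(1, 0, 0, 0), (1, 1, 1, 1)], (0, 0, 1, 2)),
    ([(0, 0, 1, 2)], (1, 2, 2, 2)),
    ([(2, 0, 0, 0)], (1, 0, 0, 0)),
    -- `headI` of the empty list is zero, and zero is represented as the empty list, which is thus
    -- its own head and tail.
    ([(2, 0, 0, 0)], (3, 0, 0, 0)),
    ([(0, 0, 1, 2)], (3, 2, 0, 1)),
    ([(7, 0, 0, 0), (2, 1, 1, 1), (0, 1, 2, 3)], (4, 0, 2, 3)),
    ([(8, 0, 0, 0), (2, 1, 1, 1), (3, 2, 3, 4), (0, 1, 3, 5), (0, 5, 1, 6)], (4, 0, 2, 6)),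
    ([(9, 0, 0, 0), (3, 1, 2, 3)], (4, 0, 1, 3)),
    ([(10, 0, 1, 2), (4, 1, 3, 4), (3, 4, 5, 6), (4, 2, 3, 7), (0, 5, 7, 8)], (4, 0, 3, 8)),
    ([(11, 0, 1, 2), (4, 2, 3, 4), (4, 1, 4, 5)], (4, 0, 3, 5)),
    ([(12, 0, 1, 2), (3, 3, 4, 5), (2, 4, 4, 4), (4, 1, 5, 6)], (4, 0, 3, 6)),
    -- The number `n + 1` is the pair of zero and `n`, so decomposing it as a pair tests for nonzero
    -- and gives the predecessor.
    ([(12, 0, 1, 2), (3, 3, 4, 5), (0, 6, 7, 4), (0, 7, 5, 8), (4, 2, 8, 9)], (4, 0, 3, 9)),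
    ([(13, 0, 1, 1), (4, 1, 2, 3), (3, 3, 4, 5), (2, 4, 4, 4)], (4, 0, 2, 5)),
    ([(13, 0, 1, 1), (4, 1, 2, 3), (3, 3, 4, 5), (0, 6, 7, 4), (4, 0, 5, 8)], (4, 0, 2, 8)),
    ([(5, 0, 1, 1), (4, 0, 1, 2)], (6, 0, 1, 2))]

theorem mem_eval_cons {f g : Code} {v u : List ℕ} :
    u ∈ (f.cons g).eval v ↔ ∃ n ∈ f.eval v, ∃ r ∈ g.eval v, u = n.headI :: r := by
  simp [Part.bind_eq_bind, Part.pure_eq_some]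

theorem mem_eval_comp {f g : Code} {v u : List ℕ} :
    u ∈ (f.comp g).eval v ↔ ∃ w ∈ g.eval v, u ∈ f.eval w := by
  rw [Code.comp_eval]
  exact Part.mem_bind_iff

theorem mem_eval_case {f g : Code} {v u : List ℕ} :
    u ∈ (f.case g).eval v ↔ (v.headI = 0 ∧ u ∈ f.eval v.tail) ∨
      ∃ n, v.headI = n + 1 ∧ u ∈ g.eval (n :: v.tail) := by
  have h : (f.case g).eval v = v.headI.rec (f.eval v.tail) fun y _ => g.eval (y :: v.tail) := by
    rw [Code.case_eval]
  rw [h]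
  generalize v.headI = m
  cases m <;> simp

theorem mem_eval_fix {f : Code} {v u : List ℕ} :
    u ∈ f.fix.eval v ↔ ∃ w ∈ f.eval v, (w.headI = 0 ∧ u = w.tail) ∨
      (w.headI ≠ 0 ∧ u ∈ f.fix.eval w.tail) := by
  rw [Code.fix_eval]
  constructor
  · intro h
    rcases PFun.mem_fix_iff.1 h with h | ⟨_, h, hu⟩ <;>
      obtain ⟨w, hw, h⟩ := (Part.mem_map_iff _).1 h <;>
      refine ⟨w, hw, ?_⟩ <;>
      split_ifs at h with h0
    · exact Or.inl ⟨h0, (Sum.inl.inj h).symm⟩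
    · obtain rfl := Sum.inr.inj h
      exact Or.inr ⟨h0, hu⟩
  · rintro ⟨w, hw, ⟨h0, rfl⟩ | ⟨h0, hu⟩⟩
    · exact PFun.mem_fix_iff.2 (Or.inl ((Part.mem_map_iff _).2 ⟨w, hw, if_pos h0⟩))
    · exact PFun.mem_fix_iff.2 (Or.inr ⟨_, (Part.mem_map_iff _).2 ⟨w, hw, if_neg h0⟩, hu⟩)

/-! #### The intended structure -/

/-- The elements of the intended structure: a program, a number and a list. -/
abbrev Datum := Code × ℕ × List ℕ

/-- The intended relations, for the program `c` on the input `i`. -/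
def intended (c : Code) (i : List ℕ) : ℕ → Datum → Datum → Datum → Prop
  -- One pairing relation serves both as successor, in the number coordinate, and as list
  -- constructor, in the list coordinate.
  | 0, x, y, z => z.2.1 = y.2.1 + 1 ∧ z.2.2 = x.2.1 :: y.2.2
  | 1, _, _, _ => True
  | 2, x, _, _ => x.2.1 = 0 ∧ x.2.2 = []
  | 3, x, y, z => y.2.1 = x.2.2.headI ∧ z.2.2 = x.2.2.tail
  | 4, x, y, z => z.2.2 ∈ x.1.eval y.2.2
  | 5, x, y, _ => x.1 = c ∧ y.2.2 = i
  | 6, _, _, _ => False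
  | 7, x, _, _ => x.1 = Code.zero'
  | 8, x, _, _ => x.1 = Code.succ
  | 9, x, _, _ => x.1 = Code.tail
  | 10, x, y, z => x.1 = y.1.cons z.1
  | 11, x, y, z => x.1 = y.1.comp z.1
  | 12, x, y, z => x.1 = y.1.case z.1
  | 13, x, y, _ => x.1 = y.1.fix
  | _, _, _, _ => False

theorem satClause_of_forall {A : Type} {T : ℕ → A → A → A → Prop} {cl : Clause}
    (h : ∀ v : ℕ → A, (∀ α ∈ cl.1, T α.1 (v α.2.1) (v α.2.2.1) (v α.2.2.2)) →
      T cl.2.1 (v cl.2.2.1) (v cl.2.2.2.1) (v cl.2.2.2.2)) : SatClause T cl :=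
  fun v hv => ⟨v, fun _ _ => rfl, h v hv⟩

/-- Divergence is needed only for the last clause, whose head relation is empty; the clauses for
relation `4` reflect the evaluation equations of `Code`. -/
theorem intended_satClause {c : Code} {i : List ℕ} (h : ¬ (c.eval i).Dom) :
    ∀ cl ∈ interpClauses, SatClause (intended c i) cl := by
  simp only [interpClauses, List.mem_cons, List.not_mem_nil, or_false, forall_eq_or_imp, forall_eq]
  refine ⟨?_, satClause_of_forall ?_, satClause_of_forall ?_, satClause_of_forall ?_,
    satClause_of_forall ?_, satClause_of_forall ?_, satClause_of_forall ?_, satClause_of_forall ?_,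
    satClause_of_forall ?_, satClause_of_forall ?_, satClause_of_forall ?_, satClause_of_forall ?_,
    satClause_of_forall ?_, satClause_of_forall ?_, satClause_of_forall ?_⟩
  · intro v _
    exact ⟨fun n => if n = 2 then (Code.zero', (v 1).2.1 + 1, (v 0).2.1 :: (v 1).2.2) else v n,
      by simp [Clause.bodyVars], rfl, rfl⟩
  all_goals
    intro v hv
    simp only [List.mem_cons, List.not_mem_nil, or_false, forall_eq_or_imp, forall_eq,
      intended] at hv ⊢
  · rw [hv.1, hv.2]
    exact ⟨rfl, rfl⟩
  · rw [hv.2]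
    exact ⟨rfl, rfl⟩
  · obtain ⟨h1, h2, h3⟩ := hv
    rw [h1, Code.zero'_eval, h3.2, h2.1]
    exact Part.mem_some _
  · obtain ⟨h1, h2, h3, h4, h5⟩ := hv
    rw [h1, Code.succ_eval, h5.2, h4.1, h3.1, h2.2]
    exact Part.mem_some _
  · obtain ⟨h1, h2⟩ := hv
    rw [h1, Code.tail_eval, h2.2]
    exact Part.mem_some _
  · obtain ⟨h1, h2, h3, h4, h5⟩ := hv
    rw [h1, mem_eval_cons]
    exact ⟨_, h2, _, h4, by rw [h5.2, h3.1]⟩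
  · obtain ⟨h1, h2, h3⟩ := hv
    rw [h1, mem_eval_comp]
    exact ⟨_, h2, h3⟩
  · obtain ⟨h1, h2, h3, h4⟩ := hv
    rw [h1, mem_eval_case]
    exact Or.inl ⟨by rw [← h2.1, h3.1], by rwa [← h2.2]⟩
  · obtain ⟨h1, h2, h3, h4, h5⟩ := hv
    rw [h1, mem_eval_case]
    exact Or.inr ⟨_, by rw [← h2.1, h3.1], by rwa [← h2.2, ← h4.2]⟩
  · obtain ⟨h1, h2, h3, h4⟩ := hv
    rw [h1, mem_eval_fix]
    exact ⟨_, h2, Or.inl ⟨by rw [← h3.1, h4.1], h3.2⟩⟩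
  · obtain ⟨h1, h2, h3, h4, h5⟩ := hv
    rw [h1, mem_eval_fix]
    refine ⟨_, h2, Or.inr ⟨by rw [← h3.1, h4.1]; exact Nat.succ_ne_zero _, ?_⟩⟩
    rw [← h3.2, ← h1]
    exact h5
  · obtain ⟨⟨h1, h2⟩, h3⟩ := hv
    rw [h1, h2] at h3
    exact h (Part.dom_iff_mem.2 ⟨_, h3⟩)

/-! #### Evaluation in an arbitrary structure -/

section Simulation

variable {D : Type} (T : ℕ → D → D → D → Prop)

/-- The element `d` represents the number `n`. -/
def NatRep : ℕ → D → Prop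
  | 0, d => T 2 d d d
  | n + 1, d => ∃ o a, T 2 o o o ∧ NatRep n a ∧ T 0 o a d

/-- The element `d` represents the list `l`. -/
def ListRep : List ℕ → D → Prop
  | [], d => T 2 d d d
  | n :: l, d => ∃ a b, NatRep T n a ∧ ListRep l b ∧ T 0 a b d

/-- The element `d` represents the program `c`. -/
def CodeRep : Code → D → Prop
  | .zero', d => T 7 d d d
  | .succ, d => T 8 d d d
  | .tail, d => T 9 d d d
  | .cons f g, d => ∃ x y, CodeRep f x ∧ CodeRep g y ∧ T 10 d x y
  | .comp f g, d => ∃ x y, CodeRep f x ∧ CodeRep g y ∧ T 11 d x y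
  | .case f g, d => ∃ x y, CodeRep f x ∧ CodeRep g y ∧ T 12 d x y
  | .fix f, d => ∃ x, CodeRep f x ∧ T 13 d x x

variable {T}

theorem SatClause.apply {cl : Clause} (h : SatClause T cl)
    (hcl : ∀ x ∈ [cl.2.2.1, cl.2.2.2.1, cl.2.2.2.2], x ∈ cl.bodyVars) (v : ℕ → D)
    (hv : ∀ α ∈ cl.1, T α.1 (v α.2.1) (v α.2.2.1) (v α.2.2.2)) :
    T cl.2.1 (v cl.2.2.1) (v cl.2.2.2.1) (v cl.2.2.2.2) := by
  obtain ⟨w, hw, hT⟩ := h v hv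
  simp only [List.mem_cons, List.not_mem_nil, or_false, forall_eq_or_imp, forall_eq] at hcl
  rwa [hw _ hcl.1, hw _ hcl.2.1, hw _ hcl.2.2] at hT

/-- Induction on the program, with an inner induction on iterations for `fix`. Intermediate lists
exist because represented numbers and lists are generated data, which the pairing clause can
combine. Representatives need not be unique, so only some representative of the output is obtained.
-/
theorem exists_eval (hT : ∀ cl ∈ interpClauses, SatClause T cl) (hnil : ∃ o, T 2 o o o) {c : Code} :
    ∀ {γ : D}, CodeRep T c γ → ∀ {i u : List ℕ}, u ∈ c.eval i → ∀ {d : D}, ListRep T i d →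
      ∃ e, ListRep T u e ∧ T 4 γ d e := by
  simp only [interpClauses, List.mem_cons, List.not_mem_nil, or_false, forall_eq_or_imp,
    forall_eq] at hT
  obtain ⟨h0, h1, h2, h3, h4, h5, h6, h7, h8, h9, h10, h11, h12, h13, -⟩ := hT
  have pair : ∀ {x y}, T 1 x x x → T 1 y y y → ∃ z, T 0 x y z := by
    intro x y hx hy
    obtain ⟨w, hw, h⟩ := h0 (fun n => if n = 0 then x else y) (by simp [hx, hy])
    refine ⟨w 2, ?_⟩
    have hw0 := hw 0 (by decide)
    have hw1 := hw 1 (by decide)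
    simp only [if_true] at hw0
    simp only [one_ne_zero, if_false] at hw1
    simpa [hw0, hw1] using h
  have anyPair : ∀ {x y z}, T 0 x y z → T 1 z z z := fun {x y z} h =>
    -- Here and below, `getD` lists the values of the clause variables in order, the last variable
    -- being the default.
    h1.apply (by decide) (fun n => [x, y].getD n z) (by simpa using h)
  have anyNil : ∀ {x}, T 2 x x x → T 1 x x x := fun {x} h =>
    h2.apply (by decide) (fun _ => x) (by simpa using h)
  have decNil : ∀ {x}, T 2 x x x → T 3 x x x := fun {x} h =>
    h3.apply (by decide) (fun _ => x) (by simpa using h)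
  have decPair : ∀ {x y z}, T 0 x y z → T 3 z x y := fun {x y z} h =>
    h4.apply (by decide) (fun n => [x, y].getD n z) (by simpa using h)
  have anyNat : ∀ {n d}, NatRep T n d → T 1 d d d := fun {n d} h => by
    cases n with
    | zero => exact anyNil h
    | succ n =>
      obtain ⟨o, a, -, -, h⟩ := h
      exact anyPair h
  have anyList : ∀ {l d}, ListRep T l d → T 1 d d d := fun {l d} h => by
    cases l with
    | nil => exact anyNil h
    | cons n l =>
      obtain ⟨o, a, -, -, h⟩ := h
      exact anyPair h
  have dec : ∀ {l d}, ListRep T l d →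
      ∃ a b, NatRep T l.headI a ∧ ListRep T l.tail b ∧ T 3 d a b := fun {l d} h => by
    cases l with
    | nil => exact ⟨d, d, h, h, decNil h⟩
    | cons n l =>
      obtain ⟨a, b, ha, hb, h⟩ := h
      exact ⟨a, b, ha, hb, decPair h⟩
  obtain ⟨o, ho⟩ := hnil
  induction c with
  | zero' =>
    intro γ hγ i u hu d hd
    rw [Code.zero'_eval] at hu
    obtain rfl := Part.mem_some_iff.1 hu
    obtain ⟨e, he⟩ := pair (anyNil ho) (anyList hd)
    exact ⟨e, ⟨o, d, ho, hd, he⟩, h5.apply (by decide) (fun n => [γ, o, d].getD n e)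
      (by simpa using ⟨hγ, ho, he⟩)⟩
  | succ =>
    intro γ hγ i u hu d hd
    rw [Code.succ_eval] at hu
    obtain rfl := Part.mem_some_iff.1 hu
    obtain ⟨a, b, ha, hb, hdab⟩ := dec hd
    obtain ⟨n, hn⟩ := pair (anyNil ho) (anyNat ha)
    obtain ⟨e, he⟩ := pair (anyPair hn) (anyNil ho)
    exact ⟨e, ⟨n, o, ⟨o, a, ho, ha, hn⟩, ho, he⟩, h6.apply (by decide)
      (fun m => [γ, o, d, a, b, n].getD m e) (by simpa using ⟨hγ, ho, hdab, hn, he⟩)⟩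
  | tail =>
    intro γ hγ i u hu d hd
    rw [Code.tail_eval] at hu
    obtain rfl := Part.mem_some_iff.1 hu
    obtain ⟨a, b, ha, hb, hdab⟩ := dec hd
    exact ⟨b, hb, h7.apply (by decide) (fun m => [γ, d, a].getD m b) (by simpa using ⟨hγ, hdab⟩)⟩
  | cons f g ihf ihg =>
    rintro γ ⟨φ, ψ, hφ, hψ, hγ⟩ i u hu d hd
    obtain ⟨n, hn, r, hr, rfl⟩ := mem_eval_cons.1 hu
    obtain ⟨x, hx, hfx⟩ := ihf hφ hn hd
    obtain ⟨y, hy, hgy⟩ := ihg hψ hr hd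
    obtain ⟨a, b, ha, hb, hxab⟩ := dec hx
    obtain ⟨e, he⟩ := pair (anyNat ha) (anyList hy)
    exact ⟨e, ⟨a, y, ha, hy, he⟩, h8.apply (by decide) (fun m => [γ, φ, ψ, d, x, a, b, y].getD m e)
      (by simpa using ⟨hγ, hfx, hxab, hgy, he⟩)⟩
  | comp f g ihf ihg =>
    rintro γ ⟨φ, ψ, hφ, hψ, hγ⟩ i u hu d hd
    obtain ⟨w, hw, hu⟩ := mem_eval_comp.1 hu
    obtain ⟨x, hx, hgx⟩ := ihg hψ hw hd
    obtain ⟨e, he, hfe⟩ := ihf hφ hu hx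
    exact ⟨e, he, h9.apply (by decide) (fun m => [γ, φ, ψ, d, x].getD m e)
      (by simpa using ⟨hγ, hgx, hfe⟩)⟩
  | case f g ihf ihg =>
    rintro γ ⟨φ, ψ, hφ, hψ, hγ⟩ i u hu d hd
    obtain ⟨a, b, ha, hb, hdab⟩ := dec hd
    rcases mem_eval_case.1 hu with ⟨h0, hu⟩ | ⟨n, hn, hu⟩
    · rw [h0] at ha
      obtain ⟨e, he, hfe⟩ := ihf hφ hu hb
      exact ⟨e, he, h10.apply (by decide) (fun m => [γ, φ, ψ, d, a, b].getD m e)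
        (by simpa using ⟨hγ, hdab, ha, hfe⟩)⟩
    · rw [hn] at ha
      obtain ⟨o', a', -, ha', hoa⟩ := ha
      obtain ⟨x, hx⟩ := pair (anyNat ha') (anyList hb)
      obtain ⟨e, he, hge⟩ := ihg hψ hu (d := x) ⟨a', b, ha', hb, hx⟩
      exact ⟨e, he, h11.apply (by decide) (fun m => [γ, φ, ψ, d, a, b, o', a', x].getD m e)
        (by simpa using ⟨hγ, hdab, hoa, hx, hge⟩)⟩
  | fix f ihf =>
    rintro γ ⟨φ, hφ, hγ⟩ i u hu
    rw [Code.fix_eval] at hu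
    -- The output `u` stays fixed while the induction runs over the successive inputs of the loop,
    -- whose representatives vary.
    refine PFun.fixInduction' (C := fun i => ∀ {d : D}, ListRep T i d →
      ∃ e, ListRep T u e ∧ T 4 γ d e) hu (fun i hi => ?_) (fun i i' _ hi ih => ?_)
    all_goals
      intro d hd
      obtain ⟨w, hw, h⟩ := (Part.mem_map_iff _).1 hi
      obtain ⟨x, hx, hfx⟩ := ihf hφ hw hd
      obtain ⟨a, b, ha, hb, hxab⟩ := dec hx
      split_ifs at h with h0
    · obtain rfl := Sum.inl.inj h
      rw [h0] at ha
      exact ⟨b, hb, h12.apply (by decide) (fun m => [γ, φ, d, x, a].getD m b)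
        (by simpa using ⟨hγ, hfx, hxab, ha⟩)⟩
    · obtain rfl := Sum.inr.inj h
      obtain ⟨n, hn⟩ := Nat.exists_eq_succ_of_ne_zero h0
      rw [hn] at ha
      obtain ⟨o', a', -, ha', hoa⟩ := ha
      obtain ⟨e, he, hbe⟩ := ih hb
      exact ⟨e, he, h13.apply (by decide) (fun m => [γ, φ, d, x, a, b, o', a'].getD m e)
        (by simpa using ⟨hγ, hfx, hxab, hoa, hbe⟩)⟩

end Simulation

/-! #### The knowledge base for a program and an input -/

/-- An injective numbering of programs. -/
def codeNum : Code → ℕ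
  | .zero' => Nat.pair 0 0
  | .succ => Nat.pair 1 0
  | .tail => Nat.pair 2 0
  | .cons f g => Nat.pair 3 (Nat.pair (codeNum f) (codeNum g))
  | .comp f g => Nat.pair 4 (Nat.pair (codeNum f) (codeNum g))
  | .case f g => Nat.pair 5 (Nat.pair (codeNum f) (codeNum g))
  | .fix f => Nat.pair 6 (codeNum f)

theorem codeNum_injective : Function.Injective codeNum := by
  intro c
  induction c with
  | zero' | succ | tail => intro d h; cases d <;> simp [codeNum, Nat.pair_eq_pair] at h ⊢
  | cons f g ihf ihg | comp f g ihf ihg | case f g ihf ihg =>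
    intro d h
    cases d <;> simp only [codeNum, Nat.pair_eq_pair] at h <;> try omega
    rw [ihf h.2.1, ihg h.2.2]
  | fix f ihf =>
    intro d h
    cases d <;> simp only [codeNum, Nat.pair_eq_pair] at h <;> try omega
    rw [ihf h.2]

/-- The relation for the shape of a program, and the components of the program. -/
def codeShape : Code → ℕ × Code × Code
  | .zero' => (7, .zero', .zero')
  | .succ => (8, .succ, .succ)
  | .tail => (9, .tail, .tail)
  | .cons f g => (10, f, g)
  | .comp f g => (11, f, g)
  | .case f g => (12, f, g)
  | .fix f => (13, f, f)

/-- The constant that denotes a program. -/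
def codeConst (c : Code) : ℕ := 8 * codeNum c + 2

/-- The fact that gives the shape of a program. -/
def shapeFact (c : Code) : HFact :=
  ((codeShape c).1, codeConst c, codeConst (codeShape c).2.1, codeConst (codeShape c).2.2,
    8 * codeNum c + 3)

/-- The facts that give the shapes of all parts of a program. -/
def codeFacts : Code → List HFact
  | .cons f g => shapeFact (.cons f g) :: (codeFacts f ++ codeFacts g)
  | .comp f g => shapeFact (.comp f g) :: (codeFacts f ++ codeFacts g)
  | .case f g => shapeFact (.case f g) :: (codeFacts f ++ codeFacts g)
  | .fix f => shapeFact (.fix f) :: codeFacts f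
  | c => [shapeFact c]

/-- The facts for the program `c` and the input `[n]`. The constant `8 * k` denotes the number `k`, and
the constant `5` denotes the input. -/
def inputFacts (c : Code) (n : ℕ) : List HFact :=
  -- Residues modulo 8 keep the constants apart: 0 for numbers, 1 for successor tuples, 2 for
  -- programs, 3 for shape tuples. The constants 4, 6 and 7 represent the remaining three tuples.
  (codeFacts c ++ [(2, 0, 0, 0, 4), (5, codeConst c, 5, 5, 7)]) ++ (0, 8 * n, 0, 5, 6) ::
    (List.range n).map fun k => (0, 0, 8 * k, 8 * (k + 1), 8 * k + 1)

theorem codeRep_of_facts {D : Type} {T : ℕ → D → D → D → Prop} {const : ℕ → D} {c : Code}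
    (h : ∀ φ ∈ codeFacts c, T φ.1 (const φ.2.1) (const φ.2.2.1) (const φ.2.2.2.1)) :
    CodeRep T c (const (codeConst c)) := by
  induction c with
  | zero' | succ | tail => exact h _ (List.mem_singleton_self _)
  | cons f g ihf ihg | comp f g ihf ihg | case f g ihf ihg =>
    simp only [codeFacts, List.mem_cons, List.mem_append, or_imp, forall_and, forall_eq] at h
    exact ⟨_, _, ihf h.2.1, ihg h.2.2, h.1⟩
  | fix f ihf =>
    simp only [codeFacts, List.mem_cons, or_imp, forall_and, forall_eq] at h
    exact ⟨_, ihf h.2, h.1⟩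

theorem exists_shapeFact {c : Code} : ∀ φ ∈ codeFacts c, ∃ d, φ = shapeFact d := by
  induction c with
  | zero' | succ | tail => exact fun φ h => ⟨_, List.mem_singleton.1 h⟩
  | cons f g ihf ihg | comp f g ihf ihg | case f g ihf ihg =>
    intro φ h
    simp only [codeFacts, List.mem_cons, List.mem_append] at h
    rcases h with h | h | h
    exacts [⟨_, h⟩, ihf φ h, ihg φ h]
  | fix f ihf =>
    intro φ h
    simp only [codeFacts, List.mem_cons] at h
    rcases h with h | h
    exacts [⟨_, h⟩, ihf φ h]

theorem natRep_of_facts {D : Type} {T : ℕ → D → D → D → Prop} {const : ℕ → D} {c : Code} {n : ℕ}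
    (h : ∀ φ ∈ inputFacts c n, T φ.1 (const φ.2.1) (const φ.2.2.1) (const φ.2.2.2.1)) :
    ∀ k ≤ n, NatRep T k (const (8 * k)) := by
  have h0 : T 2 (const 0) (const 0) (const 0) := h (2, 0, 0, 0, 4) (by simp [inputFacts])
  intro k
  induction k with
  | zero => exact fun _ => h0
  | succ k ih =>
    intro hk
    refine ⟨const 0, const (8 * k), h0, ih (by omega),
      h (0, 0, 8 * k, 8 * (k + 1), 8 * k + 1) ?_⟩
    refine List.mem_append_right _ (List.mem_cons_of_mem _ (List.mem_map.2 ⟨k, ?_, rfl⟩))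
    exact List.mem_range.2 (by omega)

/-- The datum of the intended structure that corresponds to a program. -/
def codeDatum (c : Code) : Datum := (c, 0, [])

/-- The datum of the intended structure that corresponds to a number. -/
def numDatum (n : ℕ) : Datum := (Code.zero', n, List.replicate n 0)

/-- The interpretation of the constants in the intended structure. -/
noncomputable def intendedConst (c : Code) (n m : ℕ) : EncDom Datum :=
  let d := Function.invFun codeNum (m / 8)
  match m % 8 with
  | 0 => Sum.inl (numDatum (m / 8))
  | 1 => Sum.inr (true, (0, numDatum 0, numDatum (m / 8), numDatum (m / 8 + 1)))
  | 2 => Sum.inl (codeDatum d)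
  | 3 => Sum.inr (true, ((codeShape d).1, codeDatum d, codeDatum (codeShape d).2.1,
      codeDatum (codeShape d).2.2))
  | 4 => Sum.inr (true, (2, numDatum 0, numDatum 0, numDatum 0))
  | 5 => Sum.inl (Code.zero', 1, [n])
  | 6 => Sum.inr (true, (0, numDatum n, numDatum 0, (Code.zero', 1, [n])))
  | _ => Sum.inr (true, (5, codeDatum c, (Code.zero', 1, [n]), (Code.zero', 1, [n])))

theorem intendedConst_num (c : Code) (n k : ℕ) :
    intendedConst c n (8 * k) = Sum.inl (numDatum k) := by
  simp [intendedConst]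

theorem intendedConst_succ (c : Code) (n k : ℕ) : intendedConst c n (8 * k + 1) =
    Sum.inr (true, (0, numDatum 0, numDatum k, numDatum (k + 1))) := by
  have h1 : (8 * k + 1) % 8 = 1 := by omega
  have h2 : (8 * k + 1) / 8 = k := by omega
  simp [intendedConst, h1, h2]

theorem intendedConst_codeConst (c : Code) (n : ℕ) (d : Code) :
    intendedConst c n (codeConst d) = Sum.inl (codeDatum d) := by
  have h1 : codeConst d % 8 = 2 := by simp only [codeConst]; omega
  have h2 : codeConst d / 8 = codeNum d := by simp only [codeConst]; omega
  simp [intendedConst, h1, h2, Function.leftInverse_invFun codeNum_injective d]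

theorem intendedConst_shape (c : Code) (n : ℕ) (d : Code) : intendedConst c n (8 * codeNum d + 3) =
    Sum.inr (true, ((codeShape d).1, codeDatum d, codeDatum (codeShape d).2.1,
      codeDatum (codeShape d).2.2)) := by
  have h1 : (8 * codeNum d + 3) % 8 = 3 := by omega
  have h2 : (8 * codeNum d + 3) / 8 = codeNum d := by omega
  simp [intendedConst, h1, h2, Function.leftInverse_invFun codeNum_injective d]

theorem intended_inputFacts (c : Code) (n : ℕ) : ∀ φ ∈ inputFacts c n, ∃ x y z,
    intendedConst c n φ.2.1 = Sum.inl x ∧ intendedConst c n φ.2.2.1 = Sum.inl y ∧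
      intendedConst c n φ.2.2.2.1 = Sum.inl z ∧
      intendedConst c n φ.2.2.2.2 = Sum.inr (true, (φ.1, x, y, z)) ∧
      intended c [n] φ.1 x y z := by
  intro φ hφ
  simp only [inputFacts, List.mem_append, List.mem_cons, List.not_mem_nil, or_false,
    List.mem_map] at hφ
  rcases hφ with (hφ | rfl | rfl) | rfl | ⟨k, -, rfl⟩
  · obtain ⟨d, rfl⟩ := exists_shapeFact φ hφ
    refine ⟨_, _, _, intendedConst_codeConst .., intendedConst_codeConst ..,
      intendedConst_codeConst .., intendedConst_shape .., ?_⟩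
    cases d <;> rfl
  · exact ⟨_, _, _, intendedConst_num c n 0, intendedConst_num c n 0, intendedConst_num c n 0,
      rfl, rfl, rfl⟩
  · exact ⟨_, _, _, intendedConst_codeConst .., rfl, rfl, rfl, rfl, rfl⟩
  -- Pairing forces the unused coordinates: the input `[n]`, a pair with second component zero, has
  -- number coordinate 1, and `numDatum k` must have list coordinate `List.replicate k 0` since it
  -- arises by repeatedly pairing with zero.
  · exact ⟨_, _, _, intendedConst_num c n n, intendedConst_num c n 0, rfl, rfl, rfl, rfl⟩
  · exact ⟨_, _, _, intendedConst_num c n 0, intendedConst_num c n k,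
      intendedConst_num c n (k + 1), intendedConst_succ c n k, rfl, rfl⟩

/-- If `c` diverges, the intended structure refutes the query; if it halts, the evaluation is
carried out in every model. -/
theorem entails_iff_dom (c : Code) (n : ℕ) :
    Entails (encKB (inputFacts c n) interpClauses).factBase
      (encKB (inputFacts c n) interpClauses).ruleSet {tupleQuery 6} ↔ (c.eval [n]).Dom := by
  constructor
  · intro hE
    by_contra h
    have : Inhabited Datum := ⟨numDatum 0⟩
    exact not_entails_encKB (T := intended c [n]) (j := 6) (intended_satClause h) (intended_inputFacts c n)
      (fun _ _ _ h => h) hE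
  · intro h
    obtain ⟨u, hu⟩ := Part.dom_iff_mem.1 h
    refine entails_encKB fun D const T hT hφ => ?_
    have hnum := natRep_of_facts hφ
    have hcode : CodeRep T c (const (codeConst c)) := codeRep_of_facts fun φ h =>
      hφ φ (List.mem_append_left _ (List.mem_append_left _ h))
    have hin : ListRep T [n] (const 5) :=
      ⟨const (8 * n), const 0, hnum n le_rfl, hnum 0 (Nat.zero_le n),
        hφ (0, 8 * n, 0, 5, 6) (by simp [inputFacts])⟩
    obtain ⟨e, -, he⟩ := exists_eval hT ⟨const 0, hnum 0 (Nat.zero_le n)⟩ hcode hu hin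
    have hgoal : SatClause T ([(5, 0, 1, 1), (4, 0, 1, 2)], (6, 0, 1, 2)) :=
      hT _ (by simp [interpClauses])
    have hstart : T 5 (const (codeConst c)) (const 5) (const 5) :=
      hφ (5, codeConst c, 5, 5, 7) (by simp [inputFacts])
    exact ⟨_, _, _, hgoal.apply (by decide) (fun m => [const (codeConst c), const 5].getD m e)
      (by simpa using ⟨hstart, he⟩)⟩

/-! ### Undecidability -/

theorem primrec_inputFacts (c : Code) : Primrec (inputFacts c) := by
  have h8 : ∀ {α : Type} [Primcodable α] {f : α → ℕ}, Primrec f → Primrec fun a => 8 * f a :=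
    fun hf => Primrec.nat_mul.comp (Primrec.const 8) hf
  have h1 : ∀ {α : Type} [Primcodable α] {f : α → ℕ}, Primrec f → Primrec fun a => f a + 1 :=
    fun hf => Primrec.succ.comp hf
  have hk : Primrec fun p : ℕ × ℕ => p.2 := Primrec.snd
  have hchain : Primrec₂ fun (_ k : ℕ) => ((0, 0, 8 * k, 8 * (k + 1), 8 * k + 1) : HFact) :=
    (Primrec.const 0).pair ((Primrec.const 0).pair
      ((h8 hk).pair ((h8 (h1 hk)).pair (h1 (h8 hk)))))
  have hinput : Primrec fun n => ((0, 8 * n, 0, 5, 6) : HFact) :=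
    (Primrec.const 0).pair ((h8 Primrec.id).pair (Primrec.const ((0, 5, 6) : ℕ × ℕ × ℕ)))
  exact Primrec.list_append.comp (Primrec.const _)
    (Primrec.list_cons.comp hinput (Primrec.list_map Primrec.list_range hchain))

theorem primrec_facts : Primrec HFact.facts := by
  have hadd : ∀ {f : HFact → ℕ} (k : ℕ), Primrec f → Primrec fun a => f a + k :=
    fun k hf => Primrec.nat_add.comp hf (Primrec.const k)
  have h2 : Primrec fun φ : HFact => φ.2 := Primrec.snd
  have hx : Primrec fun φ : HFact => φ.2.1 := Primrec.fst.comp h2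
  have h3 : Primrec fun φ : HFact => φ.2.2 := Primrec.snd.comp h2
  have hy : Primrec fun φ : HFact => φ.2.2.1 := Primrec.fst.comp h3
  have h4 : Primrec fun φ : HFact => φ.2.2.2 := Primrec.snd.comp h3
  have hz : Primrec fun φ : HFact => φ.2.2.2.1 := Primrec.fst.comp h4
  have hs : Primrec fun φ : HFact => φ.2.2.2.2 := Primrec.snd.comp h4
  have hj : Primrec fun φ : HFact => 3 * φ.1 := Primrec.nat_mul.comp (Primrec.const 3) Primrec.fst
  have single : ∀ {p f : HFact → ℕ}, Primrec p → Primrec f →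
      Primrec fun φ => ((p φ, [f φ]) : Fact) := fun hp hf =>
    hp.pair (Primrec.list_cons.comp hf (Primrec.const []))
  have double : ∀ {p f g : HFact → ℕ}, Primrec p → Primrec f → Primrec g →
      Primrec fun φ => ((p φ, [f φ, g φ]) : Fact) := fun hp hf hg =>
    hp.pair (Primrec.list_cons.comp hf (Primrec.list_cons.comp hg (Primrec.const [])))
  have cons : ∀ {f : HFact → Fact} {g : HFact → List Fact}, Primrec f → Primrec g →
      Primrec fun φ => f φ :: g φ := fun hf hg => Primrec.list_cons.comp hf hg
  exact cons (single (Primrec.const 1) hs) (cons (single (Primrec.const 0) hx)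
    (cons (single (Primrec.const 0) hy) (cons (single (Primrec.const 0) hz)
    (cons (double hj hx hs) (cons (double (hadd 1 hj) hy hs)
    (cons (double (hadd 2 hj) hz hs) (Primrec.const [])))))))

theorem computable_encKB (c : Code) (cls : List Clause) :
    Computable fun n => encKB (inputFacts c n) cls :=
  ((Primrec.list_flatMap (primrec_inputFacts c) (primrec_facts.comp Primrec.snd).to₂).pair
    (Primrec.const (allRules cls))).to_comp

/-- There is a program whose halting problem is undecidable. -/
theorem exists_code_not_computablePred :
    ∃ c : Code, ¬ ComputablePred fun n : ℕ => (c.eval [n]).Dom := by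
  -- The program runs the partial recursive function numbered `n` on input `0`, so its domain
  -- encodes the halting problem at `0`.
  have hp : Partrec fun n : ℕ => Nat.Partrec.Code.eval (Denumerable.ofNat Nat.Partrec.Code n) 0 :=
    Nat.Partrec.Code.eval_part.comp (Computable.ofNat _) (Computable.const 0)
  obtain ⟨c, hc⟩ := Code.exists_code (Nat.Partrec'.part_iff₁.2 hp)
  refine ⟨c, fun h => ComputablePred.halting_problem 0
    (ComputablePred.computable_of_manyOneReducible ⟨Encodable.encode, Computable.encode, ?_⟩ h)⟩
  intro d
  have := hc (Encodable.encode d ::ᵥ List.Vector.nil)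
  change c.eval [Encodable.encode d] = _ at this
  simp [this]

/-- The rule set does not vary with the input, so its single membership in `𝓒` puts all instances of
the reduction within the promise. -/
theorem not_atomicEntailmentDecidable {𝓒 : Set (Finset Rule)} (h : clauseRules interpClauses ∈ 𝓒) :
    ¬ AtomicEntailmentDecidable (plusTrans 𝓒) := by
  rintro ⟨f, hf, hdec⟩
  obtain ⟨c, hc⟩ := exists_code_not_computablePred
  have hK := fun n => hdec (encKB (inputFacts c n) interpClauses) (tupleQuery 6)
    (allRules_mem_plusTrans h)
  choose b hb hbE using hK
  refine hc (ComputablePred.computable_iff.2 ⟨b, ?_, ?_⟩)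
  -- The decider may be partial elsewhere, but on these instances it has the values `b n`, so `b` is
  -- computable.
  · exact (hf.comp ((computable_encKB c interpClauses).pair (Computable.const _))).of_eq_tot hb
  · funext n
    exact propext ((entails_iff_dom c n).symm.trans (hbE n).symm)

end ExRule

theorem mainTheorem8 :
    ¬ ExRule.AtomicEntailmentDecidable (ExRule.plusTrans ExRule.fus) ∧
      ¬ ExRule.AtomicEntailmentDecidable (ExRule.plusTrans ExRule.fes) :=
  ⟨ExRule.not_atomicEntailmentDecidable (ExRule.clauseRules_mem_fus _),
    ExRule.not_atomicEntailmentDecidable (ExRule.clauseRules_mem_fes _)⟩
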